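/- Let $U$ be a non-empty set and let $\mathbb{R}^U$ carry its cylindrical $\sigma$-algebra $\mathcal{B}(\mathbb{R})^U$. Let $X=(X_u)_{u\in U}$ be a real-valued random field on a probability space $(\Omega,\mathcal F,\mathbb P)$ that is infinitely divisible, i.e. for every $n\ge 1$ it is equal in law to a sum of $n$ independent, identically distributed fields. $X$ is called selfdecomposable if for every $q>1$ there are a copy $X'$ of $X$ and a field $V^{(q)}$ independent of $X'$ such that $X\overset{d}{=}q^{-1}X'+V^{(q)}$. For finite $\hat u\subset U$ let $(\gamma_{\hat u},B_{\hat u},\nu_{\hat u})$ be the characteristic (Lévy–Khintchine) triplet of $X_{\hat u}=(X_u)_{u\in\hat u}$ with respect to the truncation function $\tau(x)=(x_i/(1\vee|x_i|))_i$, and let $\pi_{\hat u}:\mathbb{R}^U\to\mathbb{R}^{\hat u}$ be the projection. A measure $\nu$ on $\mathcal{B}(\mathbb{R})^U$ is a pseudo master Lévy measure of $X$ if $\nu_{\hat u}(A)=\nu(\pi_{\hat u}^{-1}(A))$ for every finite $\hat u\subset U$ and every Borel set $A\subset\mathbb{R}^{\hat u}\setminus\{0\}$, and $\int_{\mathbb{R}^U}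 1\wedge |x_u|^2\,\nu(dx)<\infty$ for every $u\in U$. It does not charge zero if $\nu(\{x: x_u=0 \text{ for all } u\in U_0\})=0$ for some countable $U_0\subset U$; a pseudo master Lévy measure that does not charge zero is the master Lévy measure of $X$. $X$ has characteristic triplet $(\Gamma,B,\nu)$, with $\Gamma:U\to\mathbb{R}$ and $B:U\times U\to\mathbb{R}$, if $\nu$ is the master Lévy measure of $X$ and $\gamma_{\hat u}=(\Gamma(u))_{u\in\hat u}$, $B_{\hat u}=(B(u,v))_{u,v\in\hat u}$ for every finite $\hat u\subset U$. (i) If $X$ has characteristic triplet $(\Gamma,B,\nu)$, then $X$ is selfdecomposable if and only if for every $q>1$ $$\nu(qA)\le\nu(A)\qquad\text{for all }A\in\mathcal{B}(\mathbb{R})^U. \tag{$*$}$$ (ii) If some pseudo master Lévy measure $\nu$ of $X$ (possibly charging zero) satisfies $(*)$ for every $q>1$, then $X$ is selfdecomposable. -/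

import Mathlib

open MeasureTheory ProbabilityTheory
open scoped Pointwise ENNReal RealInnerProductSpace

universe u v

/-- The truncation function `τ(x)ᵢ = xᵢ / (1 ∨ |xᵢ|)` on Euclidean space. -/
noncomputable def levyTruncation {ι : Type*} (x : EuclideanSpace ℝ ι) : EuclideanSpace ℝ ι :=
  WithLp.toLp 2 fun i => x i / max 1 |x i|

/-- A Lévy measure on Euclidean space: no mass at the origin and `∫ 1 ∧ |x|² dν < ∞`. -/
structure IsLevyMeasure {ι : Type*} [Fintype ι] (ν : Measure (EuclideanSpace ℝ ι)) : Prop where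
  measure_zero : ν {0} = 0
  lintegral_lt_top : ∫⁻ x, ENNReal.ofReal (min 1 (‖x‖ ^ 2)) ∂ν < ∞

/-- The Lévy-Khintchine exponent of `(γ, B, ν)`:
`i⟨θ, γ⟩ - ⟨θ, Bθ⟩ / 2 + ∫ (exp (i⟨θ, x⟩) - 1 - i⟨τ(x), θ⟩) ν(dx)`. -/
noncomputable def levyKhintchineExponent {ι : Type*} [Fintype ι] (γ : EuclideanSpace ℝ ι)
    (B : Matrix ι ι ℝ) (ν : Measure (EuclideanSpace ℝ ι)) (θ : EuclideanSpace ℝ ι) : ℂ :=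
  Complex.I * (⟪θ, γ⟫ : ℝ) - ((1 / 2 * (θ.ofLp ⬝ᵥ B.mulVec θ.ofLp) : ℝ) : ℂ)
    + ∫ x, (Complex.exp (Complex.I * (⟪θ, x⟫ : ℝ)) - 1
        - Complex.I * (⟪levyTruncation x, θ⟫ : ℝ)) ∂ν

/-- `(γ, B, ν)` is the characteristic triplet of the law `μ`. -/
structure IsCharacteristicTriplet {ι : Type*} [Fintype ι] (μ : Measure (EuclideanSpace ℝ ι))
    (γ : EuclideanSpace ℝ ι) (B : Matrix ι ι ℝ) (ν : Measure (EuclideanSpace ℝ ι)) : Prop where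
  posSemidef : B.PosSemidef
  isLevyMeasure : IsLevyMeasure ν
  charFun_eq : ∀ θ, charFun μ θ = Complex.exp (levyKhintchineExponent γ B ν θ)

/-- The projection `ℝ^U → ℝ^s` onto finitely many coordinates. -/
noncomputable def finProj {U : Type u} (s : Finset U) (x : U → ℝ) : EuclideanSpace ℝ s :=
  WithLp.toLp 2 fun i => x i

/-- The path map `ω ↦ (X u ω)_u` of a field `X`. -/
def fieldPath {U : Type u} {Ω : Type v} (X : U → Ω → ℝ) : Ω → U → ℝ := fun ω i => X i ω

/-- Infinite divisibility: for every `n ≥ 1` the field `X` has the law of a sum of `n` independent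
and identically distributed fields, defined on some probability space. (Since only laws on
`ℝ^U` and its finite powers matter, the universe of `U` is large enough for that space.) -/
def IsInfinitelyDivisibleField {U : Type u} {Ω : Type v} [MeasurableSpace Ω]
    (X : U → Ω → ℝ) (P : Measure Ω) : Prop :=
  ∀ n : ℕ, 1 ≤ n → ∃ (Ω' : Type u) (_ : MeasurableSpace Ω') (P' : Measure Ω')
    (Y : Fin n → U → Ω' → ℝ), IsProbabilityMeasure P' ∧ (∀ i j, Measurable (Y i j)) ∧
      iIndepFun (fun i => fieldPath (Y i)) P' ∧
      (∀ i j, IdentDistrib (fieldPath (Y i)) (fieldPath (Y j)) P' P') ∧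
      IdentDistrib (fieldPath X) (fun ω => ∑ i, fieldPath (Y i) ω) P P'

/-- Selfdecomposability: for every `q > 1` there are, on some probability space, a copy `X'` of `X`
and a field `V` independent of `X'` such that `X` has the law of `q⁻¹ X' + V`. -/
def IsSelfdecomposableField {U : Type u} {Ω : Type v} [MeasurableSpace Ω]
    (X : U → Ω → ℝ) (P : Measure Ω) : Prop :=
  ∀ q : ℝ, 1 < q → ∃ (Ω' : Type u) (_ : MeasurableSpace Ω') (P' : Measure Ω')
    (X' V : U → Ω' → ℝ), IsProbabilityMeasure P' ∧
      (∀ j, Measurable (X' j)) ∧ (∀ j, Measurable (V j)) ∧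
      IdentDistrib (fieldPath X') (fieldPath X) P' P ∧
      IndepFun (fieldPath X') (fieldPath V) P' ∧
      IdentDistrib (fieldPath X) (fun ω => q⁻¹ • fieldPath X' ω + fieldPath V ω) P P'

/-- `(γ s, B s, ν s)` is, for every finite `s ⊆ U`, the characteristic triplet of `(X_u)_{u ∈ s}`. -/
def IsCharacteristicSystem {U : Type u} {Ω : Type v} [MeasurableSpace Ω]
    (X : U → Ω → ℝ) (P : Measure Ω) (γ : (s : Finset U) → EuclideanSpace ℝ s)
    (B : (s : Finset U) → Matrix s s ℝ) (ν : (s : Finset U) → Measure (EuclideanSpace ℝ s)) :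
    Prop :=
  ∀ s : Finset U,
    IsCharacteristicTriplet (P.map fun ω => finProj s (fieldPath X ω)) (γ s) (B s) (ν s)

/-- A measure on `ℝ^U` does not charge zero if `ν(π_{U₀}⁻¹(0)) = 0` for some countable `U₀ ⊆ U`. -/
def DoesNotChargeZero {U : Type u} (ν : Measure (U → ℝ)) : Prop :=
  ∃ U₀ : Set U, U₀.Countable ∧ ν {x | ∀ j ∈ U₀, x j = 0} = 0

/-- Pseudo master Lévy measures of `X`: measures on the cylindrical σ-algebra of `ℝ^U` whose
finite-dimensional projections agree, off the origin, with the Lévy measures of the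
finite-dimensional distributions of `X`, and which satisfy `∫ 1 ∧ |x_u|² dν < ∞` for all `u`. -/
structure IsPseudoMasterLevyMeasure {U : Type u} {Ω : Type v} [MeasurableSpace Ω]
    (X : U → Ω → ℝ) (P : Measure Ω) (ν : Measure (U → ℝ)) : Prop where
  exists_system : ∃ (γ : (s : Finset U) → EuclideanSpace ℝ s)
    (B : (s : Finset U) → Matrix s s ℝ) (η : (s : Finset U) → Measure (EuclideanSpace ℝ s)),
    IsCharacteristicSystem X P γ B η ∧
      ∀ (s : Finset U) (A : Set (EuclideanSpace ℝ s)), MeasurableSet A → 0 ∉ A →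
        η s A = ν (finProj s ⁻¹' A)
  lintegral_lt_top : ∀ j : U, ∫⁻ x, ENNReal.ofReal (min 1 (|x j| ^ 2)) ∂ν < ∞

/-- The master Lévy measure of `X`: a pseudo master Lévy measure that does not charge zero. -/
structure IsMasterLevyMeasure {U : Type u} {Ω : Type v} [MeasurableSpace Ω]
    (X : U → Ω → ℝ) (P : Measure Ω) (ν : Measure (U → ℝ)) : Prop where
  isPseudoMaster : IsPseudoMasterLevyMeasure X P ν
  doesNotChargeZero : DoesNotChargeZero ν

/-- The field `X` has characteristic triplet `(Γ, B, ν)`. -/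
structure HasCharacteristicTriplet {U : Type u} {Ω : Type v} [MeasurableSpace Ω]
    (X : U → Ω → ℝ) (P : Measure Ω) (Γ : U → ℝ) (B : U → U → ℝ) (ν : Measure (U → ℝ)) :
    Prop where
  exists_system : ∃ η : (s : Finset U) → Measure (EuclideanSpace ℝ s),
    IsCharacteristicSystem X P (fun s => finProj s Γ)
      (fun s => Matrix.of fun i j : s => B i j) η
  isMaster : IsMasterLevyMeasure X P ν

/-! Let `φ = exp ψ` be the characteristic function of a finite-dimensional law of the field.
Selfdecomposability at `q` asks that `φ(θ) / φ(q⁻¹θ)` be a characteristic function. Formally this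
quotient has Gaussian part `(1 - q⁻²)B` and jump part `ν` minus the image of `ν` under `x ↦ q⁻¹x`;
the theorem says that positivity of this signed measure is decisive.

Sufficiency: after small jumps are cut off, the difference is a finite positive measure, so the
quotient is a limit of Gaussian laws convolved with compound Poisson laws, and Lévy's continuity
theorem applies (`exists_charFun_eq_exp_sub`). As `φ` has no zeros, the quotient laws are unique,
hence consistent, and Kolmogorov extension produces the field `V`
(`isSelfdecomposableField_of_charFun`). Only sets avoiding the origin of some `ℝ^s` enter, so a
pseudo master Lévy measure is enough.

Necessity: that the quotient is a characteristic function does not by itself make the jump part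
positive; the quotients for all scales are needed. Writing `q` as the `(n + 1)`-st power of `r`
splits the quotient into scaled copies of the innovation at `r`, which form an infinitesimal
triangular array. Its suitably centred factors give compound Poisson exponents converging to `ψ(θ) -
ψ(q⁻¹θ)` (`exists_tendsto_compound_poisson_exponent`). Symmetric second differences remove drifts
and turn exponents into characteristic functions of finite measures with weight `1 - cos⟪η, x⟫`;
weak limits preserve inequalities between these (`withDensity_map_smul_le`), and dividing by the
weight gives the inequality off the origin. The inequality lifts from cylinders to the whole
σ-algebra because a measure that does not charge zero lives on countably many sets `{|x_j| > ε}`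
(`measure_le_of_finProj_preimage_le`). -/

/-! ### Kolmogorov extension over an arbitrary index set -/

section KolmogorovExtension

variable {U : Type*}

/-- Cylinders over compact bases with the finite intersection property have a common point. -/
theorem nonempty_iInter_cylinder_of_isCompact {I : ℕ → Finset U} {K : ∀ n, Set (I n → ℝ)}
    (hK : ∀ n, IsCompact (K n)) (h : ∀ n, (⋂ k ≤ n, cylinder (α := fun _ => ℝ) (I k) (K k)).Nonempty) :
    (⋂ n, cylinder (α := fun _ => ℝ) (I n) (K n)).Nonempty := by
  classical
  choose x hx using h
  replace hx : ∀ n, ∀ k ≤ n, (I k).restrict (x n) ∈ K k := fun n k hk => by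
    have := hx n
    simp only [Set.mem_iInter] at this
    exact this k hk
  -- The first index set containing `j` already confines coordinate `j` to a compact set. The value
  -- `0` is added for the points `y n` below, which vanish at coordinates not yet constrained at
  -- stage `n`; Tychonoff then applies to the product of the `J j`.
  let J : U → Set ℝ := fun j => if hj : ∃ k, j ∈ I k then
    insert 0 ((fun y : I (Nat.find hj) → ℝ => y ⟨j, Nat.find_spec hj⟩) '' K (Nat.find hj)) else {0}
  have hJ : ∀ j, IsCompact (J j) := fun j => by
    by_cases hj : ∃ k, j ∈ I k
    · simp only [J, dif_pos hj]
      exact ((hK _).image (by fun_prop)).insert 0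
    · simp only [J, dif_neg hj]
      exact isCompact_singleton
  let y : ℕ → U → ℝ := fun n j => if ∃ k ≤ n, j ∈ I k then x n j else 0
  have hyK : ∀ n, ∀ k ≤ n, (I k).restrict (y n) ∈ K k := fun n k hk => by
    convert hx n k hk using 1
    ext j
    exact if_pos ⟨k, hk, j.2⟩
  have hyJ : ∀ n, y n ∈ Set.univ.pi J := fun n j _ => by
    by_cases hj : ∃ k ≤ n, j ∈ I k
    · have hj' : ∃ k, j ∈ I k := ⟨hj.choose, hj.choose_spec.2⟩
      have hle : Nat.find hj' ≤ n := (Nat.find_min' hj' hj.choose_spec.2).trans hj.choose_spec.1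
      simp only [J, dif_pos hj', y, if_pos hj]
      exact Or.inr ⟨_, hx n _ hle, rfl⟩
    · simp only [y, if_neg hj, J]
      split_ifs
      · exact Or.inl rfl
      · rfl
  have hclosed : ∀ k, IsClosed (cylinder (α := fun _ => ℝ) (I k) (K k)) := fun k =>
    (hK k).isClosed.preimage (by unfold Finset.restrict; fun_prop)
  have hpi : IsCompact (Set.univ.pi J) := isCompact_univ_pi hJ
  let D : ℕ → Set (U → ℝ) := fun n => Set.univ.pi J ∩ ⋂ k ≤ n, cylinder (α := fun _ => ℝ) (I k) (K k)
  have hDclosed : ∀ n, IsClosed (D n) := fun n =>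
    hpi.isClosed.inter (isClosed_iInter fun k => isClosed_iInter fun _ => hclosed k)
  obtain ⟨z, hz⟩ := IsCompact.nonempty_iInter_of_sequence_nonempty_isCompact_isClosed D
    (fun n => Set.inter_subset_inter_right _
      (Set.biInter_subset_biInter_left fun k hk => Nat.le_succ_of_le hk))
    (fun n => ⟨y n, hyJ n, Set.mem_iInter₂.2 fun k hk => hyK n k hk⟩)
    (hpi.of_isClosed_subset (hDclosed 0) Set.inter_subset_left) hDclosed
  refine ⟨z, Set.mem_iInter.2 fun n => ?_⟩
  have := (Set.mem_iInter.1 hz n).2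
  simp only [Set.mem_iInter] at this
  exact this n le_rfl

/-- Continuity at the empty set, from inner regularity. If the contents stayed above a positive
infimum, the bases could be shrunk to compact sets at a total cost below that infimum, and
compactness would give a point common to all `s n`. -/
theorem tendsto_projectiveFamilyContent_zero {P : ∀ I : Finset U, Measure (I → ℝ)}
    [∀ I, IsFiniteMeasure (P I)] (hP : IsProjectiveMeasureFamily (α := fun _ => ℝ) P) {s : ℕ → Set (U → ℝ)}
    (hs : ∀ n, s n ∈ measurableCylinders fun _ : U => ℝ) (hanti : Antitone s)
    (hempty : ⋂ n, s n = ∅) :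
    Filter.Tendsto (fun n => projectiveFamilyContent hP (s n)) Filter.atTop (nhds 0) := by
  have hmono : Antitone fun n => projectiveFamilyContent hP (s n) := fun i j hij =>
    projectiveFamilyContent_mono hP (hs j) (hs i) (hanti hij)
  have hlim := tendsto_atTop_iInf hmono
  by_contra hne
  have hε : (⨅ n, projectiveFamilyContent hP (s n)) ≠ 0 := fun h0 => hne (h0 ▸ hlim)
  obtain ⟨δ, hδ, hδsum⟩ := ENNReal.exists_pos_sum_of_countable' hε ℕ
  choose I S hS hsS using fun n => (mem_measurableCylinders (s n)).1 (hs n)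
  have hKex : ∀ n, ∃ K ⊆ S n, IsCompact K ∧ P (I n) (S n \ K) < δ n := fun n =>
    (hS n).exists_isCompact_sdiff_lt (measure_ne_top _ _) (hδ n).ne'
  choose K hKS hK hPK using hKex
  have hmeas : ∀ n, MeasurableSet (S n \ K n) := fun n => (hS n).diff (hK n).measurableSet
  have hfin : ∀ n, (⋂ k ≤ n, cylinder (α := fun _ => ℝ) (I k) (K k)).Nonempty := fun n => by
    by_contra hB
    -- If the compact cylinders had no common point, the discarded pieces would cover `s n`, whose
    -- content exceeds `∑ δ`.
    have hsub : s n ⊆ ⋃ k ≤ n, cylinder (α := fun _ => ℝ) (I k) (S k \ K k) := fun x hx => by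
      by_contra hx'
      refine hB ⟨x, ?_⟩
      simp only [Set.mem_iInter, Set.mem_iUnion, not_exists] at hx' ⊢
      intro k hk
      have h1 : x ∈ s k := hanti hk hx
      rw [hsS k] at h1
      by_contra h2
      exact hx' k hk ⟨h1, h2⟩
    have hcyl : ∀ k, cylinder (α := fun _ => ℝ) (I k) (S k \ K k) ∈ measurableCylinders fun _ : U => ℝ := fun k =>
      cylinder_mem_measurableCylinders _ _ (hmeas k)
    have h1 : projectiveFamilyContent hP (s n) ≤ ∑ k ∈ Finset.range (n + 1), δ k := by
      refine (projectiveFamilyContent_mono hP (hs n) ?_ hsub).trans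
        ((projectiveFamilyContent_iUnion_le hP hcyl n).trans (Finset.sum_le_sum fun k _ => ?_))
      · have := isSetRing_measurableCylinders.biUnion_mem
          (Finset.range (n + 1)) (fun k _ => hcyl k)
        simpa only [Finset.mem_range_succ_iff] using this
      · rw [projectiveFamilyContent_cylinder hP (hmeas k)]
        exact (hPK k).le
    exact absurd ((iInf_le _ n).trans (h1.trans (ENNReal.sum_le_tsum _))) (not_le.2 hδsum)
  obtain ⟨z, hz⟩ := nonempty_iInter_cylinder_of_isCompact hK hfin
  have : z ∈ ⋂ n, s n := Set.mem_iInter.2 fun n => by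
    rw [hsS n]
    exact hKS n (Set.mem_iInter.1 hz n)
  rw [hempty] at this
  exact this

/-- The Kolmogorov extension theorem for real-valued coordinates. -/
theorem exists_isProjectiveLimit {P : ∀ I : Finset U, Measure (I → ℝ)}
    [∀ I, IsFiniteMeasure (P I)] (hP : IsProjectiveMeasureFamily (α := fun _ => ℝ) P) :
    ∃ μ : Measure (U → ℝ), IsProjectiveLimit (α := fun _ => ℝ) μ P := by
  have hsub : (projectiveFamilyContent hP).IsSigmaSubadditive :=
    isSigmaSubadditive_of_addContent_iUnion_eq_tsum isSetRing_measurableCylinders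
      fun f hf hfU hd => addContent_iUnion_eq_sum_of_tendsto_zero isSetRing_measurableCylinders
        (projectiveFamilyContent hP) (fun s _ => projectiveFamilyContent_ne_top hP)
        (fun s hs hanti hempty => tendsto_projectiveFamilyContent_zero hP hs hanti hempty)
        hf hfU hd
  refine ⟨(projectiveFamilyContent hP).measure isSetSemiring_measurableCylinders
    generateFrom_measurableCylinders.ge hsub, fun I => ?_⟩
  ext S hS
  rw [Measure.map_apply (Finset.measurable_restrict I) hS, ← cylinder,
    AddContent.measure_eq _ _ generateFrom_measurableCylinders.symm _
      (cylinder_mem_measurableCylinders _ _ hS)]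
  exact projectiveFamilyContent_cylinder hP hS

end KolmogorovExtension

/-! ### Bounds and continuity for the Lévy–Khintchine exponent -/

section LevyKernel

variable {ι : Type*}

theorem Complex.norm_exp_I_mul_sub_one_sub_le (y : ℝ) :
    ‖Complex.exp (Complex.I * y) - 1 - Complex.I * y‖ ≤ 2 * y ^ 2 := by
  rcases le_or_gt |y| 1 with hy | hy
  · have := Complex.norm_exp_sub_one_sub_id_le (x := Complex.I * y) (by simpa using hy)
    simp only [norm_mul, Complex.norm_I, Complex.norm_real, one_mul, Real.norm_eq_abs,
      sq_abs] at this
    nlinarith [sq_nonneg y]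
  · calc _ ≤ ‖Complex.exp (Complex.I * y) - 1‖ + ‖Complex.I * (y : ℂ)‖ := norm_sub_le _ _
      _ ≤ |y| + |y| := add_le_add Real.norm_exp_I_mul_ofReal_sub_one_le (by simp)
      _ ≤ 2 * y ^ 2 := by nlinarith [sq_abs y]

@[fun_prop]
theorem measurable_levyTruncation [Fintype ι] :
    Measurable (levyTruncation : EuclideanSpace ℝ ι → EuclideanSpace ℝ ι) := by
  unfold levyTruncation
  fun_prop

theorem levyTruncation_eq_self [Fintype ι] {x : EuclideanSpace ℝ ι} (hx : ‖x‖ ≤ 1) :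
    levyTruncation x = x := by
  ext i
  have : |x i| ≤ 1 := (PiLp.norm_apply_le x i).trans hx
  simp [levyTruncation, max_eq_left this]

theorem norm_levyTruncation_sq_le [Fintype ι] (x : EuclideanSpace ℝ ι) :
    ‖levyTruncation x‖ ^ 2 ≤ Fintype.card ι * min 1 (‖x‖ ^ 2) := by
  rw [EuclideanSpace.norm_sq_eq, ← nsmul_eq_mul, ← Finset.card_univ]
  refine Finset.sum_le_card_nsmul _ _ _ fun i _ => ?_
  have hm : (1 : ℝ) ≤ max 1 |x i| := le_max_left _ _
  have h0 : 0 < max 1 |x i| := one_pos.trans_le hm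
  have habs : ‖(levyTruncation x).ofLp i‖ = |x i| / max 1 |x i| := by
    simp [levyTruncation, abs_of_pos h0]
  rw [habs]
  refine le_min ?_ ?_
  · exact pow_le_one₀ (by positivity) ((div_le_one h0).2 (le_max_right _ _))
  · have h1 : |x i| / max 1 |x i| ≤ ‖x‖ :=
      (div_le_self (abs_nonneg _) hm).trans (PiLp.norm_apply_le x i)
    gcongr

/-- The integrand of the Lévy-Khintchine exponent. -/
noncomputable def levyKernel [Fintype ι] (θ x : EuclideanSpace ℝ ι) : ℂ :=
  Complex.exp (Complex.I * (⟪θ, x⟫ : ℝ)) - 1 - Complex.I * (⟪levyTruncation x, θ⟫ : ℝ)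

variable [Fintype ι]

@[fun_prop]
theorem measurable_levyKernel (θ : EuclideanSpace ℝ ι) : Measurable (levyKernel θ) := by
  unfold levyKernel
  fun_prop

theorem continuous_levyKernel (x : EuclideanSpace ℝ ι) :
    Continuous fun θ => levyKernel θ x := by
  unfold levyKernel
  fun_prop

/-- On the unit ball truncation is the identity and the kernel is a second-order Taylor remainder;
outside it the kernel is bounded in `x`, because the truncation is. This is the domination behind
every integrability and continuity claim about exponents. -/
theorem norm_levyKernel_le (θ x : EuclideanSpace ℝ ι) :
    ‖levyKernel θ x‖ ≤ (2 + Fintype.card ι) * (1 + ‖θ‖ ^ 2) * min 1 (‖x‖ ^ 2) := by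
  have hc : (0 : ℝ) ≤ Fintype.card ι := Nat.cast_nonneg _
  rcases le_or_gt ‖x‖ 1 with hx | hx
  · have h1 : ‖x‖ ^ 2 ≤ 1 := pow_le_one₀ (norm_nonneg _) hx
    rw [levyKernel, levyTruncation_eq_self hx, real_inner_comm x θ, min_eq_right h1]
    refine (Complex.norm_exp_I_mul_sub_one_sub_le _).trans ?_
    have h2 : ⟪θ, x⟫ ^ 2 ≤ ‖θ‖ ^ 2 * ‖x‖ ^ 2 := by
      rw [← mul_pow, ← sq_abs]
      gcongr
      exact abs_real_inner_le_norm _ _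
    rw [real_inner_comm]
    calc 2 * ⟪θ, x⟫ ^ 2 ≤ 2 * (‖θ‖ ^ 2 * ‖x‖ ^ 2) := by gcongr
      _ = 2 * ‖θ‖ ^ 2 * ‖x‖ ^ 2 := by ring
      _ ≤ (2 + Fintype.card ι) * (1 + ‖θ‖ ^ 2) * ‖x‖ ^ 2 := by
        gcongr <;> linarith [sq_nonneg ‖θ‖]
  · have h1 : 1 ≤ ‖x‖ ^ 2 := one_le_pow₀ hx.le
    rw [min_eq_left h1, mul_one]
    have h2 : ‖levyTruncation x‖ ^ 2 ≤ Fintype.card ι := by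
      simpa [min_eq_left h1] using norm_levyTruncation_sq_le x
    have h3 : |⟪levyTruncation x, θ⟫| ≤ ‖levyTruncation x‖ * ‖θ‖ := abs_real_inner_le_norm _ _
    have h4 : ‖levyKernel θ x‖ ≤ 2 + |⟪levyTruncation x, θ⟫| := by
      refine (norm_sub_le _ _).trans (add_le_add ((norm_sub_le _ _).trans ?_) ?_)
      · rw [Complex.norm_exp_I_mul_ofReal, norm_one]; norm_num
      · simp
    nlinarith [sq_nonneg (‖levyTruncation x‖ - ‖θ‖), sq_nonneg ‖θ‖, mul_nonneg hc (sq_nonneg ‖θ‖)]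

theorem levyKernel_zero_left (x : EuclideanSpace ℝ ι) : levyKernel 0 x = 0 := by
  simp [levyKernel]

theorem levyKernel_zero_right (θ : EuclideanSpace ℝ ι) : levyKernel θ 0 = 0 := by
  simp [levyKernel, levyTruncation_eq_self (x := (0 : EuclideanSpace ℝ ι)) (by simp)]

/-- The symmetric second difference of the Lévy kernel in its first variable. -/
theorem levyKernel_sub_half_add (θ η x : EuclideanSpace ℝ ι) :
    levyKernel θ x - (levyKernel (θ + η) x + levyKernel (θ - η) x) / 2
      = Complex.exp (Complex.I * (⟪θ, x⟫ : ℝ)) * ((1 - Real.cos ⟪η, x⟫ : ℝ) : ℂ) := by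
  simp only [levyKernel, inner_add_left, inner_sub_left, inner_add_right, inner_sub_right]
  push_cast
  rw [Complex.cos, mul_add, mul_sub, sub_eq_add_neg (Complex.I * (⟪θ, x⟫ : ℂ)), Complex.exp_add,
    Complex.exp_add, mul_comm (⟪η, x⟫ : ℂ) Complex.I, neg_mul, mul_comm (⟪η, x⟫ : ℂ) Complex.I]
  ring

variable {ν : Measure (EuclideanSpace ℝ ι)}

theorem IsLevyMeasure.integrable_min_one_sq (hν : IsLevyMeasure ν) :
    Integrable (fun x => min 1 (‖x‖ ^ 2)) ν := by
  refine ⟨by fun_prop, ?_⟩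
  rw [hasFiniteIntegral_iff_ofReal (Filter.Eventually.of_forall fun x => by positivity)]
  exact hν.lintegral_lt_top

theorem IsLevyMeasure.integrable_levyKernel (hν : IsLevyMeasure ν) (θ : EuclideanSpace ℝ ι) :
    Integrable (levyKernel θ) ν :=
  (hν.integrable_min_one_sq.const_mul _).mono' (by fun_prop)
    (Filter.Eventually.of_forall fun x => norm_levyKernel_le θ x)

theorem levyKhintchineExponent_eq (γ : EuclideanSpace ℝ ι) (B : Matrix ι ι ℝ)
    (ν : Measure (EuclideanSpace ℝ ι)) (θ : EuclideanSpace ℝ ι) :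
    levyKhintchineExponent γ B ν θ
      = Complex.I * (⟪θ, γ⟫ : ℝ) - ((1 / 2 * (θ.ofLp ⬝ᵥ B.mulVec θ.ofLp) : ℝ) : ℂ)
        + ∫ x, levyKernel θ x ∂ν := rfl

theorem levyKhintchineExponent_zero (γ : EuclideanSpace ℝ ι) (B : Matrix ι ι ℝ)
    (ν : Measure (EuclideanSpace ℝ ι)) : levyKhintchineExponent γ B ν 0 = 0 := by
  simp [levyKhintchineExponent_eq, levyKernel_zero_left]

theorem IsLevyMeasure.continuous_integral_levyKernel (hν : IsLevyMeasure ν) :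
    Continuous fun θ => ∫ x, levyKernel θ x ∂ν := by
  refine continuous_iff_continuousAt.2 fun θ₀ => ?_
  refine continuousAt_of_dominated
    (bound := fun x => (2 + Fintype.card ι) * (1 + (‖θ₀‖ + 1) ^ 2) * min 1 (‖x‖ ^ 2))
    (Filter.Eventually.of_forall fun θ => (measurable_levyKernel θ).aestronglyMeasurable) ?_
    (hν.integrable_min_one_sq.const_mul _)
    (Filter.Eventually.of_forall fun x => (continuous_levyKernel x).continuousAt)
  have : ∀ᶠ θ in nhds θ₀, ‖θ‖ < ‖θ₀‖ + 1 :=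
    continuous_norm.continuousAt.eventually_lt_const (lt_add_one _)
  filter_upwards [this] with θ hθ
  refine Filter.Eventually.of_forall fun x => (norm_levyKernel_le θ x).trans ?_
  gcongr

theorem IsLevyMeasure.continuous_levyKhintchineExponent (hν : IsLevyMeasure ν)
    (γ : EuclideanSpace ℝ ι) (B : Matrix ι ι ℝ) :
    Continuous (levyKhintchineExponent γ B ν) := by
  have := hν.continuous_integral_levyKernel
  simp only [funext (levyKhintchineExponent_eq γ B ν)]
  refine Continuous.add (Continuous.sub (by fun_prop) ?_) this
  refine Complex.continuous_ofReal.comp (continuous_const.mul ?_)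
  exact Continuous.dotProduct (by fun_prop) (Continuous.matrix_mulVec continuous_const (by fun_prop))

/-- The real part of a Lévy-Khintchine exponent grows at most quadratically. -/
theorem IsLevyMeasure.exists_neg_re_levyKhintchineExponent_le (hν : IsLevyMeasure ν)
    (γ : EuclideanSpace ℝ ι) (B : Matrix ι ι ℝ) :
    ∃ C : ℝ, 0 ≤ C ∧ ∀ θ, -(levyKhintchineExponent γ B ν θ).re ≤ C * (1 + ‖θ‖ ^ 2) := by
  classical
  let T := (Matrix.toEuclideanCLM (n := ι) (𝕜 := ℝ) B)
  let c := ∫ x, min 1 (‖x‖ ^ 2) ∂ν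
  have hc : 0 ≤ c := integral_nonneg fun x => by positivity
  refine ⟨‖T‖ + (2 + Fintype.card ι) * c, by positivity, fun θ => ?_⟩
  have h1 : ‖∫ x, levyKernel θ x ∂ν‖ ≤ (2 + Fintype.card ι) * (1 + ‖θ‖ ^ 2) * c := by
    rw [← integral_const_mul]
    exact norm_integral_le_of_norm_le (hν.integrable_min_one_sq.const_mul _)
      (Filter.Eventually.of_forall fun x => norm_levyKernel_le θ x)
  have h2 : θ.ofLp ⬝ᵥ B.mulVec θ.ofLp ≤ ‖T‖ * ‖θ‖ ^ 2 := by
    have h3 : θ.ofLp ⬝ᵥ B.mulVec θ.ofLp = ⟪T θ, θ⟫ := by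
      simp [T, EuclideanSpace.inner_eq_star_dotProduct]
    rw [h3]
    calc ⟪T θ, θ⟫ ≤ ‖T θ‖ * ‖θ‖ := real_inner_le_norm _ _
      _ ≤ ‖T‖ * ‖θ‖ * ‖θ‖ := by gcongr; exact T.le_opNorm θ
      _ = ‖T‖ * ‖θ‖ ^ 2 := by ring
  have h4 := (Complex.abs_re_le_norm _).trans h1
  rw [levyKhintchineExponent_eq]
  simp only [Complex.add_re, Complex.sub_re, Complex.ofReal_re, Complex.mul_re, Complex.I_re,
    Complex.I_im, Complex.ofReal_im]
  have h5 := (abs_le.1 h4).1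
  have := norm_nonneg T
  nlinarith [sq_nonneg ‖θ‖, mul_nonneg this (sq_nonneg ‖θ‖)]

end LevyKernel

/-! ### Lévy continuity and order under weak limits -/

section WeakConvergence

variable {E : Type*} [NormedAddCommGroup E] [InnerProductSpace ℝ E] [FiniteDimensional ℝ E]
  [MeasurableSpace E] [BorelSpace E]

/-- Lévy's continuity theorem, existence part: a pointwise limit of characteristic functions which
is continuous at the origin is a characteristic function. -/
theorem exists_charFun_eq_of_tendsto {μ : ℕ → Measure E} [∀ n, IsProbabilityMeasure (μ n)]
    {f : E → ℂ} (hf : ContinuousAt f 0)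
    (h : ∀ t, Filter.Tendsto (fun n => charFun (μ n) t) Filter.atTop (nhds (f t))) :
    ∃ ρ : Measure E, IsProbabilityMeasure ρ ∧ ∀ t, charFun ρ t = f t := by
  have htight := isTightMeasureSet_of_tendsto_charFun hf h
  let S : ℕ → ProbabilityMeasure E := fun n => ⟨μ n, inferInstance⟩
  have hcomp : IsCompact (closure (Set.range S)) := by
    refine isCompact_closure_of_isTightMeasureSet ?_
    convert htight using 1
    ext ρ
    exact ⟨fun ⟨_, ⟨n, hn⟩, h⟩ => ⟨n, h ▸ hn ▸ rfl⟩, fun ⟨n, hn⟩ => ⟨_, ⟨n, rfl⟩, hn⟩⟩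
  -- Tightness gives a compact closure by Prokhorov; a limit along an ultrafilter replaces the
  -- choice of a convergent subsequence.
  let F : Ultrafilter ℕ := Ultrafilter.of Filter.atTop
  have hF : (F : Filter ℕ) ≤ Filter.atTop := Ultrafilter.of_le _
  obtain ⟨ρ, -, hρ⟩ := hcomp.ultrafilter_le_nhds (F.map S) (by
    refine Filter.le_principal_iff.2 (Filter.mem_map.2 (Filter.univ_mem' fun n => ?_))
    exact subset_closure ⟨n, rfl⟩)
  refine ⟨ρ, inferInstance, fun t => ?_⟩
  have hρ' : Filter.Tendsto S F (nhds ρ) := hρ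
  rw [ProbabilityMeasure.tendsto_iff_forall_integral_rclike_tendsto ℂ] at hρ'
  have h1 := hρ' (BoundedContinuousFunction.innerProbChar t)
  refine tendsto_nhds_unique ?_ ((h t).mono_left hF)
  simp only [charFun_eq_integral_innerProbChar]
  exact h1

/-- The total mass is the characteristic function at `0`, so it converges; after normalization this
is Lévy's theorem for probability measures. A nonzero limit is needed to divide by its mass. -/
theorem tendsto_finiteMeasure_of_tendsto_charFun {μ : ℕ → FiniteMeasure E} {μ₀ : FiniteMeasure E}
    (h₀ : μ₀ ≠ 0) (h : ∀ t, Filter.Tendsto (fun n => charFun (μ n : Measure E) t) Filter.atTop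
      (nhds (charFun (μ₀ : Measure E) t))) :
    Filter.Tendsto μ Filter.atTop (nhds μ₀) := by
  have hmass : Filter.Tendsto (fun n => (μ n).mass) Filter.atTop (nhds μ₀.mass) := by
    have h1 := h 0
    simp only [charFun_zero] at h1
    rw [← NNReal.tendsto_coe]
    exact (Complex.continuous_re.tendsto _).comp h1
  have hm₀ : μ₀.mass ≠ 0 := μ₀.mass_nonzero_iff.2 h₀
  have hchar : ∀ {κ : FiniteMeasure E}, κ.mass ≠ 0 → ∀ t,
      charFun (κ.normalize : Measure E) t = (κ.mass : ℂ)⁻¹ * charFun (κ : Measure E) t := by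
    intro κ hκ t
    rw [κ.toMeasure_normalize_eq_of_nonzero (κ.mass_nonzero_iff.1 hκ), charFun_apply, charFun_apply,
      integral_smul_nnreal_measure]
    simp [NNReal.smul_def]
  refine FiniteMeasure.tendsto_of_tendsto_normalize_testAgainstNN_of_tendsto_mass ?_ hmass
  refine ProbabilityMeasure.tendsto_of_tendsto_charFun fun t => ?_
  rw [hchar hm₀]
  have hmc : Filter.Tendsto (fun n => ((μ n).mass : ℂ)) Filter.atTop (nhds (μ₀.mass : ℂ)) :=
    (Complex.continuous_ofReal.tendsto _).comp (NNReal.tendsto_coe.2 hmass)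
  refine ((hmc.inv₀ (by exact_mod_cast hm₀)).mul (h t)).congr' ?_
  filter_upwards [hmass.eventually_ne hm₀] with n hn
  exact (hchar hn t).symm

/-- Lower bounds of finite measures pass to limits of characteristic functions. -/
theorem measure_le_of_tendsto_charFun {μ : ℕ → Measure E} {μ₀ ρ : Measure E}
    [∀ n, IsFiniteMeasure (μ n)] [IsFiniteMeasure μ₀] [IsFiniteMeasure ρ]
    (h : ∀ t, Filter.Tendsto (fun n => charFun (μ n) t) Filter.atTop (nhds (charFun μ₀ t)))
    (hle : ∀ n, ρ ≤ μ n) : ρ ≤ μ₀ := by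
  rcases eq_or_ne μ₀ 0 with h0 | h0
  · subst h0
    have h1 := h 0
    simp only [charFun_zero] at h1
    have h2 : Filter.Tendsto (fun n => (μ n).real Set.univ) Filter.atTop (nhds 0) := by
      have h3 := (Complex.continuous_re.tendsto _).comp h1
      rw [measureReal_zero_apply] at h3
      exact h3
    have h3 : ρ.real Set.univ ≤ 0 := ge_of_tendsto' h2 fun n =>
      ENNReal.toReal_mono (measure_ne_top _ _) (hle n _)
    have h4 : ρ Set.univ = 0 := by
      have := le_antisymm h3 measureReal_nonneg
      rwa [measureReal_eq_zero_iff] at this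
    rw [Measure.measure_univ_eq_zero.1 h4]
  · let κ : ℕ → FiniteMeasure E := fun n => ⟨μ n, inferInstance⟩
    let κ₀ : FiniteMeasure E := ⟨μ₀, inferInstance⟩
    have hκ₀ : κ₀ ≠ 0 := fun hz => h0 (congrArg Subtype.val hz)
    have hlim : Filter.Tendsto κ Filter.atTop (nhds κ₀) :=
      tendsto_finiteMeasure_of_tendsto_charFun hκ₀ h
    -- The portmanteau inequality for closed sets points in the required direction; inner regularity
    -- of `ρ` extends the bound to Borel sets.
    have hclosed : ∀ F, IsClosed F → ρ F ≤ μ₀ F := fun F hF =>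
      (Filter.le_limsup_of_frequently_le (Filter.Frequently.of_forall fun n => hle n F)).trans
        (FiniteMeasure.limsup_measure_closed_le_of_tendsto hlim hF)
    refine Measure.le_iff.2 fun A hA => ?_
    rw [hA.measure_eq_iSup_isClosed_of_ne_top (measure_ne_top ρ A)]
    exact iSup₂_le fun F hFA => iSup_le fun hF => (hclosed F hF).trans (measure_mono hFA)

end WeakConvergence

/-! ### Size of a symmetrized law in terms of its characteristic function -/

section Symmetrization

variable {E : Type*} [NormedAddCommGroup E] [InnerProductSpace ℝ E] [FiniteDimensional ℝ E]
  [MeasurableSpace E] [BorelSpace E]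

theorem charFun_map_sub_prod (ρ : Measure E) [IsFiniteMeasure ρ] (t : E) :
    charFun ((ρ.prod ρ).map fun p => p.1 - p.2) t = ((‖charFun ρ t‖ ^ 2 : ℝ) : ℂ) := by
  rw [charFun_apply, integral_map (by fun_prop) (by fun_prop)]
  have h1 : ∀ p : E × E, Complex.exp (⟪p.1 - p.2, t⟫ * Complex.I)
      = Complex.exp (⟪p.1, t⟫ * Complex.I) * Complex.exp (⟪p.2, -t⟫ * Complex.I) := fun p => by
    rw [← Complex.exp_add, inner_sub_left, inner_neg_right]
    push_cast
    ring_nf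
  simp_rw [h1]
  rw [integral_prod_mul (fun x : E => Complex.exp (⟪x, t⟫ * Complex.I))
    (fun x : E => Complex.exp (⟪x, -t⟫ * Complex.I)), ← charFun_apply, ← charFun_apply, charFun_neg,
    Complex.mul_conj, Complex.normSq_eq_norm_sq]

theorem integral_charFun_comm (μ ν : Measure E) [IsFiniteMeasure μ] [IsFiniteMeasure ν] :
    ∫ t, charFun μ t ∂ν = ∫ x, charFun ν x ∂μ := by
  simp only [charFun_apply]
  rw [integral_integral_swap]
  · simp_rw [real_inner_comm]
  · refine Integrable.of_bound (C := 1) (by fun_prop) (Filter.Eventually.of_forall fun p => ?_)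
    simp [Function.uncurry, Complex.norm_exp_ofReal_mul_I]

/-- From `exp(-s/2) ≤ 1/(1 + s/2)` the right side is at least `3s/(2 + s)`; the constant `3` makes
this equal to `1` at `s = 1`. -/
theorem min_one_le_three_mul_one_sub_exp {s : ℝ} (hs : 0 ≤ s) :
    min 1 s ≤ 3 * (1 - Real.exp (-s / 2)) := by
  have h1 : Real.exp (-s / 2) ≤ (1 + s / 2)⁻¹ := by
    rw [neg_div, Real.exp_neg]
    exact inv_anti₀ (by positivity) (by linarith [Real.add_one_le_exp (s / 2)])
  have h2 : min 1 s ≤ 3 * (1 - (1 + s / 2)⁻¹) := by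
    have h3 : 3 * (1 - (1 + s / 2)⁻¹) = 3 * s / (2 + s) := by field_simp; ring
    rw [h3, le_div_iff₀ (by positivity)]
    rcases le_total s 1 with h | h
    · rw [min_eq_right h]; nlinarith
    · rw [min_eq_left h]; nlinarith
  linarith

/-- The symmetrization has characteristic function `|φ|²`, and the standard Gaussian has
`exp(-|z|²/2)`. By Fubini the Gaussian average of `1 - |φ|²` is therefore the mean of `1 -
exp(-|z|²/2)` under the symmetrization, which controls the truncated second moment. -/
theorem integral_min_one_norm_sub_sq_le (ρ : Measure E) [IsProbabilityMeasure ρ] :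
    ∫ p, min 1 (‖p.1 - p.2‖ ^ 2) ∂(ρ.prod ρ)
      ≤ 3 * ∫ t, (1 - ‖charFun ρ t‖ ^ 2) ∂(stdGaussian E) := by
  let σ := (ρ.prod ρ).map fun p => p.1 - p.2
  have hσ : IsProbabilityMeasure σ := Measure.isProbabilityMeasure_map (by fun_prop)
  have hint : Integrable (fun t => ‖charFun ρ t‖ ^ 2) (stdGaussian E) := by
    refine Integrable.of_bound (C := 1) (by fun_prop) (Filter.Eventually.of_forall fun t => ?_)
    rw [Real.norm_of_nonneg (by positivity)]
    exact pow_le_one₀ (norm_nonneg _) (norm_charFun_le_one t)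
  have hint' : Integrable (fun z => Real.exp (-‖z‖ ^ 2 / 2)) σ := by
    refine Integrable.of_bound (C := 1) (by fun_prop) (Filter.Eventually.of_forall fun t => ?_)
    rw [Real.norm_of_nonneg (by positivity), Real.exp_le_one_iff]
    linarith [sq_nonneg ‖t‖]
  have h1 : ∫ t, ‖charFun ρ t‖ ^ 2 ∂(stdGaussian E) = ∫ z, Real.exp (-‖z‖ ^ 2 / 2) ∂σ := by
    have := integral_charFun_comm σ (stdGaussian E)
    simp only [σ, charFun_map_sub_prod, charFun_stdGaussian] at this
    rw [integral_complex_ofReal] at this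
    have h2 : ∀ z : E, Complex.exp (-(‖z‖ : ℂ) ^ 2 / 2) = ((Real.exp (-‖z‖ ^ 2 / 2) : ℝ) : ℂ) :=
      fun z => by push_cast; rfl
    simp only [h2] at this
    rw [integral_complex_ofReal] at this
    exact_mod_cast this
  rw [integral_sub (integrable_const _) hint, h1]
  simp only [integral_const, probReal_univ, smul_eq_mul, mul_one]
  have h3 : ∫ p, min 1 (‖p.1 - p.2‖ ^ 2) ∂(ρ.prod ρ) = ∫ z, min 1 (‖z‖ ^ 2) ∂σ := by
    rw [integral_map (by fun_prop) (by fun_prop)]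
  have h4 : (1 : ℝ) - ∫ z, Real.exp (-‖z‖ ^ 2 / 2) ∂σ = ∫ z, (1 - Real.exp (-‖z‖ ^ 2 / 2)) ∂σ := by
    rw [integral_sub (integrable_const _) hint']
    simp
  rw [h3, h4, ← integral_const_mul]
  refine integral_mono ?_ (((integrable_const _).sub hint').const_mul _)
    fun z => min_one_le_three_mul_one_sub_exp (sq_nonneg _)
  refine Integrable.of_bound (C := 1) (by fun_prop) (Filter.Eventually.of_forall fun t => ?_)
  rw [Real.norm_of_nonneg (by positivity)]
  exact min_le_left _ _

end Symmetrization

/-! ### Centring a law by its symmetrized size -/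

section Centering

variable {ι : Type*} [Fintype ι]

/-- A suitable translate of a probability measure has a characteristic function close to `1`,
in terms of the size of its symmetrization. -/
theorem exists_norm_charFun_map_sub_sub_one_le (ρ : Measure (EuclideanSpace ℝ ι))
    [IsProbabilityMeasure ρ] :
    ∃ b : EuclideanSpace ℝ ι, ∀ θ, ‖charFun (ρ.map fun x => x - b) θ - 1‖
      ≤ (2 + 3 * Fintype.card ι) * (1 + ‖θ‖ ^ 2)
        * ∫ p, min 1 (‖p.1 - p.2‖ ^ 2) ∂(ρ.prod ρ) := by
  set e := ∫ p, min 1 (‖p.1 - p.2‖ ^ 2) ∂(ρ.prod ρ) with he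
  have hintp : Integrable (fun p : EuclideanSpace ℝ ι × EuclideanSpace ℝ ι =>
      min 1 (‖p.1 - p.2‖ ^ 2)) (ρ.prod ρ) := by
    refine Integrable.of_bound (C := 1) (by fun_prop) (Filter.Eventually.of_forall fun t => ?_)
    rw [Real.norm_of_nonneg (by positivity)]
    exact min_le_left _ _
  rw [integral_prod _ hintp] at he
  -- By Fubini, `e` is an average over `m` of the truncated second moment around `m`, so some `m`
  -- does at least as well as the average.
  obtain ⟨m, hm⟩ := exists_le_integral hintp.integral_prod_left
  rw [← he] at hm
  simp only [norm_sub_rev m] at hm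
  have hint : Integrable (fun x => min 1 (‖x - m‖ ^ 2)) ρ := by
    refine Integrable.of_bound (C := 1) (by fun_prop) (Filter.Eventually.of_forall fun t => ?_)
    rw [Real.norm_of_nonneg (by positivity)]
    exact min_le_left _ _
  have hd : (0 : ℝ) ≤ Fintype.card ι := Nat.cast_nonneg _
  have hτle : ∀ x : EuclideanSpace ℝ ι, ‖levyTruncation x‖ ≤ 1 + Fintype.card ι := fun x => by
    have h1 := norm_levyTruncation_sq_le x
    have h2 : min 1 (‖x‖ ^ 2) ≤ 1 := min_le_left _ _
    nlinarith [norm_nonneg (levyTruncation x), sq_nonneg (‖levyTruncation x‖ - 1)]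
  have hτint : Integrable (fun x : EuclideanSpace ℝ ι => levyTruncation (x - m)) ρ :=
    Integrable.of_bound (C := 1 + Fintype.card ι) (Measurable.aestronglyMeasurable (by fun_prop))
      (Filter.Eventually.of_forall fun x => hτle _)
  let c := ∫ x, levyTruncation (x - m) ∂ρ
  -- The further shift by the truncated mean `c` removes the first-order term, which would only be
  -- of order `√e`.
  refine ⟨m + c, fun θ => ?_⟩
  set a := ⟪c, θ⟫ with ha
  let H := ∫ x, levyKernel θ (x - m) ∂ρ
  have hH : ‖H‖ ≤ (2 + Fintype.card ι) * (1 + ‖θ‖ ^ 2) * e := by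
    refine (norm_integral_le_of_norm_le (hint.const_mul _)
      (Filter.Eventually.of_forall fun x => norm_levyKernel_le θ (x - m))).trans ?_
    rw [integral_const_mul]
    gcongr
  have haint : a = ∫ x, ⟪levyTruncation (x - m), θ⟫ ∂ρ := by
    rw [ha, real_inner_comm, ← integral_inner hτint]
    simp_rw [real_inner_comm]
  have hfint : Integrable (fun x => ⟪levyTruncation (x - m), θ⟫) ρ := hτint.inner_const _
  have hfle : ∀ x : EuclideanSpace ℝ ι,
      ⟪levyTruncation (x - m), θ⟫ ^ 2 ≤ Fintype.card ι * ‖θ‖ ^ 2 * min 1 (‖x - m‖ ^ 2) :=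
    fun x => by
    have h1 : ⟪levyTruncation (x - m), θ⟫ ^ 2 ≤ ‖levyTruncation (x - m)‖ ^ 2 * ‖θ‖ ^ 2 := by
      rw [← mul_pow, ← sq_abs]
      gcongr
      exact abs_real_inner_le_norm _ _
    have h2 := mul_le_mul_of_nonneg_right (norm_levyTruncation_sq_le (x - m)) (sq_nonneg ‖θ‖)
    linarith
  have hf2int : Integrable (fun x => ⟪levyTruncation (x - m), θ⟫ ^ 2) ρ :=
    (hint.const_mul (Fintype.card ι * ‖θ‖ ^ 2)).mono' (hfint.aestronglyMeasurable.pow 2)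
      (Filter.Eventually.of_forall fun x => by
        rw [Real.norm_of_nonneg (sq_nonneg _)]; exact hfle x)
  have ha2 : a ^ 2 ≤ Fintype.card ι * ‖θ‖ ^ 2 * e := by
    have h1 : a ^ 2 ≤ ∫ x, ⟪levyTruncation (x - m), θ⟫ ^ 2 ∂ρ := by
      rw [haint]
      exact (even_two.convexOn_pow).map_integral_le (by fun_prop) isClosed_univ
        (Filter.Eventually.of_forall fun _ => Set.mem_univ _) hfint hf2int
    refine h1.trans ((integral_mono hf2int (hint.const_mul _) hfle).trans ?_)
    rw [integral_const_mul]
    gcongr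
  have hexpint : Integrable (fun x => Complex.exp (Complex.I * (⟪θ, x - m⟫ : ℝ))) ρ :=
    Integrable.of_bound (C := 1) (by fun_prop)
      (Filter.Eventually.of_forall fun x => (Complex.norm_exp_I_mul_ofReal _).le)
  have hHeq : ∫ x, Complex.exp (Complex.I * (⟪θ, x - m⟫ : ℝ)) ∂ρ = 1 + Complex.I * a + H := by
    have h1 : H = ∫ x, (Complex.exp (Complex.I * (⟪θ, x - m⟫ : ℝ)) - 1
        - Complex.I * (⟪levyTruncation (x - m), θ⟫ : ℝ)) ∂ρ := rfl
    have h2 : Integrable (fun x => Complex.I * ((⟪levyTruncation (x - m), θ⟫ : ℝ) : ℂ)) ρ :=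
      hfint.ofReal.const_mul _
    have h3 : Integrable (fun x => Complex.exp (Complex.I * (⟪θ, x - m⟫ : ℝ)) - 1) ρ :=
      hexpint.sub (integrable_const _)
    rw [h1, integral_sub h3 h2, integral_sub hexpint (integrable_const _), integral_const_mul, integral_complex_ofReal, ← haint]
    simp
  have hchar : charFun (ρ.map fun x => x - (m + c)) θ
      = Complex.exp (Complex.I * ((-a : ℝ) : ℂ)) * (1 + Complex.I * a + H) := by
    rw [charFun_apply, integral_map (by fun_prop) (by fun_prop), ← hHeq, ← integral_const_mul]
    congr 1
    ext x
    rw [← Complex.exp_add, ha, real_inner_comm]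
    simp only [inner_sub_right, inner_add_right, real_inner_comm θ]
    push_cast
    ring_nf
  have hunit : Complex.exp (Complex.I * ((-a : ℝ) : ℂ)) * Complex.exp (Complex.I * (a : ℂ)) = 1 := by
    rw [← Complex.exp_add]
    push_cast
    ring_nf
    simp
  -- The centred characteristic function is `exp(-ia)(1 + ia + H)`. What remains is `H` and the
  -- second-order remainder of `exp(ia)`, where `a²` is of order `e` by Jensen.
  have hsplit : charFun (ρ.map fun x => x - (m + c)) θ - 1
      = Complex.exp (Complex.I * ((-a : ℝ) : ℂ))
        * (H - (Complex.exp (Complex.I * (a : ℂ)) - 1 - Complex.I * a)) := by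
    rw [hchar]
    linear_combination hunit
  rw [hsplit, norm_mul, Complex.norm_exp_I_mul_ofReal, one_mul]
  calc _ ≤ ‖H‖ + ‖Complex.exp (Complex.I * (a : ℂ)) - 1 - Complex.I * a‖ := norm_sub_le _ _
    _ ≤ (2 + Fintype.card ι) * (1 + ‖θ‖ ^ 2) * e + 2 * (Fintype.card ι * ‖θ‖ ^ 2 * e) :=
      add_le_add hH ((Complex.norm_exp_I_mul_sub_one_sub_le a).trans (by gcongr))
    _ ≤ (2 + 3 * Fintype.card ι) * (1 + ‖θ‖ ^ 2) * e := by
      have he0 : 0 ≤ e := integral_nonneg fun p => by positivity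
      nlinarith [mul_nonneg hd he0]

end Centering

/-! ### The triangular array of innovations and its compound Poisson approximation -/

section TriangularArray

/-- A continuous logarithm starting at `0` of a path staying near `1` is the principal one. -/
theorem log_exp_eq_of_norm_exp_sub_one_lt {f : ℝ → ℂ} (hf : Continuous f) (h0 : f 0 = 0)
    (h : ∀ t ∈ Set.Icc (0 : ℝ) 1, ‖Complex.exp (f t) - 1‖ < 1) :
    Complex.log (Complex.exp (f 1)) = f 1 := by
  have key : ∀ t ∈ Set.Icc (0 : ℝ) 1, |(f t).im| ≠ Real.pi := fun t ht hpi => by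
    have h1 : (Complex.exp (f t)).re ≤ 0 := by
      rw [Complex.exp_re, ← Real.cos_abs, hpi, Real.cos_pi]
      linarith [Real.exp_pos (f t).re]
    have h2 := (abs_le.1 ((Complex.abs_re_le_norm _).trans (h t ht).le)).1
    have h3 := (Complex.abs_re_le_norm (Complex.exp (f t) - 1)).trans_lt (h t ht)
    rw [Complex.sub_re, Complex.one_re] at h3
    linarith [(abs_lt.1 h3).1]
  have hlt : |(f 1).im| < Real.pi := by
    by_contra hge
    have hcont : ContinuousOn (fun t => |(f t).im|) (Set.Icc 0 1) := by fun_prop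
    obtain ⟨t, ht, htpi⟩ := intermediate_value_Icc zero_le_one hcont
      (show Real.pi ∈ Set.Icc |(f 0).im| |(f 1).im| from
        ⟨by simp [h0, Real.pi_pos.le], not_lt.1 hge⟩)
    exact key t ht htpi
  exact Complex.log_exp (abs_lt.1 hlt).1 (abs_lt.1 hlt).2.le

theorem norm_log_sub_le {z : ℂ} (hz : ‖z - 1‖ ≤ 1 / 2) :
    ‖Complex.log z - (z - 1)‖ ≤ ‖z - 1‖ ^ 2 := by
  have h1 := Complex.norm_log_one_add_sub_self_le (z := z - 1) (by linarith)
  rw [add_sub_cancel] at h1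
  refine h1.trans ?_
  have h2 : (1 - ‖z - 1‖)⁻¹ ≤ 2 := by
    rw [inv_le_comm₀ (by linarith) two_pos]
    linarith
  nlinarith [sq_nonneg ‖z - 1‖]

variable {ι : Type*} [Fintype ι]

theorem integrable_sq_norm_stdGaussian {E : Type*} [NormedAddCommGroup E] [InnerProductSpace ℝ E]
    [FiniteDimensional ℝ E] [MeasurableSpace E] [BorelSpace E] :
    Integrable (fun x : E => ‖x‖ ^ 2) (stdGaussian E) :=
  (IsGaussian.memLp_two_id (μ := stdGaussian E)).integrable_norm_pow two_ne_zero

/-- The scaled increments `ψ(aᵏθ) - ψ(aᵏ⁺¹θ)` are uniformly small when `a` is near `1`. -/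
theorem tendsto_increment_zero {E F : Type*} [NormedAddCommGroup E] [NormedSpace ℝ E]
    [NormedAddCommGroup F] {ψ : E → F} (hψ : Continuous ψ)
    {a : ℕ → ℝ} (ha0 : ∀ n, 0 < a n) (ha1 : ∀ n, a n < 1)
    (ha : Filter.Tendsto a Filter.atTop (nhds 1)) (k : ℕ → ℕ) (θ : E) :
    Filter.Tendsto (fun n => ψ (a n ^ k n • θ) - ψ (a n ^ (k n + 1) • θ))
      Filter.atTop (nhds 0) := by
  -- All points `aᵏθ` lie on the segment from `0` to `θ`, and consecutive ones are within `(1 -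
  -- a)‖θ‖`. Uniform continuity there permits an arbitrary index `k n`, in particular the one
  -- maximizing over a row.
  have huc : UniformContinuousOn (fun t : ℝ => ψ (t • θ)) (Set.Icc 0 1) :=
    isCompact_Icc.uniformContinuousOn_of_continuous (by fun_prop)
  rw [Metric.uniformContinuousOn_iff] at huc
  rw [Metric.tendsto_atTop]
  intro ε hε
  obtain ⟨δ, hδ, h⟩ := huc ε hε
  obtain ⟨N, hN⟩ := Metric.tendsto_atTop.1 ha δ hδ
  refine ⟨N, fun n hn => ?_⟩
  have hmem : ∀ j : ℕ, a n ^ j ∈ Set.Icc (0 : ℝ) 1 := fun j =>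
    ⟨pow_nonneg (ha0 n).le j, pow_le_one₀ (ha0 n).le (ha1 n).le⟩
  have hd := h _ (hmem (k n)) _ (hmem (k n + 1)) (by
    have h1 := hN n hn
    rw [Real.dist_eq] at h1 ⊢
    have h2 : a n ^ k n - a n ^ (k n + 1) = a n ^ k n * (1 - a n) := by ring
    rw [h2, abs_mul, abs_of_nonneg (hmem _).1, abs_sub_comm]
    exact (mul_le_of_le_one_left (abs_nonneg _) (hmem _).2).trans_lt h1)
  rwa [dist_zero_right, ← dist_eq_norm]

/-- The rows of the triangular array of scaled innovations have bounded total symmetrized size and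
vanishing maximal symmetrized size. -/
theorem exists_bound_array {ψ : EuclideanSpace ℝ ι → ℂ} (hψ : Continuous ψ)
    (hre : ∀ θ, (ψ θ).re ≤ 0) {C : ℝ} (hC : ∀ θ, -(ψ θ).re ≤ C * (1 + ‖θ‖ ^ 2))
    {a : ℕ → ℝ} (ha0 : ∀ n, 0 < a n) (ha1 : ∀ n, a n < 1)
    (ha : Filter.Tendsto a Filter.atTop (nhds 1))
    {ρ : ℕ → ℕ → Measure (EuclideanSpace ℝ ι)} [∀ n k, IsProbabilityMeasure (ρ n k)]
    (hρ : ∀ n k θ, charFun (ρ n k) θ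
      = Complex.exp (ψ (a n ^ k • θ) - ψ (a n ^ (k + 1) • θ))) :
    ∃ (S : ℝ) (ε : ℕ → ℝ), Filter.Tendsto ε Filter.atTop (nhds 0) ∧
      (∀ n, ∀ k ∈ Finset.range (n + 1),
        ∫ p, min 1 (‖p.1 - p.2‖ ^ 2) ∂((ρ n k).prod (ρ n k)) ≤ ε n) ∧
      ∀ n, ∑ k ∈ Finset.range (n + 1),
        ∫ p, min 1 (‖p.1 - p.2‖ ^ 2) ∂((ρ n k).prod (ρ n k)) ≤ S := by
  let γ := stdGaussian (EuclideanSpace ℝ ι)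
  let G : ℕ → ℕ → ℝ := fun n k => ∫ θ, (1 - ‖charFun (ρ n k) θ‖ ^ 2) ∂γ
  have hle : ∀ n k, ∫ p, min 1 (‖p.1 - p.2‖ ^ 2) ∂((ρ n k).prod (ρ n k)) ≤ 3 * G n k :=
    fun n k => integral_min_one_norm_sub_sq_le (ρ n k)
  have hbd : ∀ n k θ, ‖1 - ‖charFun (ρ n k) θ‖ ^ 2‖ ≤ 1 := fun n k θ => by
    have h1 : ‖charFun (ρ n k) θ‖ ^ 2 ≤ 1 :=
      pow_le_one₀ (norm_nonneg _) (norm_charFun_le_one θ)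
    rw [Real.norm_eq_abs, abs_le]
    constructor <;> nlinarith [sq_nonneg ‖charFun (ρ n k) θ‖]
  have hint : ∀ n k, Integrable (fun θ => 1 - ‖charFun (ρ n k) θ‖ ^ 2) γ := fun n k =>
    Integrable.of_bound (C := 1) (by fun_prop) (Filter.Eventually.of_forall (hbd n k))
  -- With `κ n` a maximizer in row `n`, uniform smallness over the row becomes dominated convergence
  -- along one sequence.
  choose κ hκmem hκ using fun n : ℕ =>
    Finset.exists_max_image (Finset.range (n + 1)) (G n) ⟨0, by simp⟩
  refine ⟨3 * ∫ θ, 2 * (C * (1 + ‖θ‖ ^ 2)) ∂γ, fun n => 3 * G n (κ n), ?_,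
    fun n k hk => (hle n k).trans (by have := hκ n k hk; linarith), fun n => ?_⟩
  · have h0 : Filter.Tendsto (fun n => G n (κ n)) Filter.atTop (nhds (∫ _, (0 : ℝ) ∂γ)) := by
      refine tendsto_integral_of_dominated_convergence (fun _ => 1)
        (fun n => (hint n _).aestronglyMeasurable) (integrable_const _)
        (fun n => Filter.Eventually.of_forall (hbd n _)) (Filter.Eventually.of_forall fun θ => ?_)
      have h1 := tendsto_increment_zero hψ ha0 ha1 ha κ θ
      have h2 : Filter.Tendsto (fun n => 1 - ‖charFun (ρ n (κ n)) θ‖ ^ 2) Filter.atTop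
          (nhds (1 - ‖Complex.exp 0‖ ^ 2)) := by
        simp only [hρ]
        exact (((Complex.continuous_exp.tendsto _).comp h1).norm.pow 2).const_sub 1
      simpa using h2
    simpa using h0.const_mul 3
  · refine (Finset.sum_le_sum fun k _ => hle n k).trans ?_
    rw [← Finset.mul_sum, ← integral_finsetSum _ fun k _ => hint n k]
    refine mul_le_mul_of_nonneg_left (integral_mono (integrable_finsetSum _ fun k _ => hint n k)
      ((((integrable_const 1).add integrable_sq_norm_stdGaussian).const_mul C).const_mul 2)
      fun θ => ?_) (by norm_num)
    -- Since `1 - exp(2x) ≤ -2x`, the row sum is bounded by a telescoping sum of real parts of `ψ`.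
    -- Its far end is nonpositive and is dropped, leaving quadratic growth in `θ`, which is Gaussian
    -- integrable.
    have h1 : ∀ k, 1 - ‖charFun (ρ n k) θ‖ ^ 2
        ≤ -2 * ((ψ (a n ^ k • θ)).re - (ψ (a n ^ (k + 1) • θ)).re) := fun k => by
      rw [hρ, Complex.norm_exp, ← Real.exp_nat_mul, Complex.sub_re]
      have := Real.add_one_le_exp (((2 : ℕ) : ℝ)
        * ((ψ (a n ^ k • θ)).re - (ψ (a n ^ (k + 1) • θ)).re))
      push_cast at this ⊢
      linarith
    refine (Finset.sum_le_sum fun k _ => h1 k).trans ?_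
    rw [← Finset.mul_sum, Finset.sum_range_sub' (fun k => (ψ (a n ^ k • θ)).re), pow_zero, one_smul]
    linarith [hC θ, hre (a n ^ (n + 1) • θ)]

theorem charFun_finsetSum {E α : Type*} [NormedAddCommGroup E] [InnerProductSpace ℝ E]
    [MeasurableSpace E] [BorelSpace E] [SecondCountableTopology E] (s : Finset α)
    (μ : α → Measure E) [∀ k, IsFiniteMeasure (μ k)] (θ : E) :
    charFun (∑ k ∈ s, μ k) θ = ∑ k ∈ s, charFun (μ k) θ := by
  simp only [charFun_apply]
  refine integral_finsetSum_measure fun k _ => ?_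
  refine Integrable.of_bound (C := 1) (by fun_prop) (Filter.Eventually.of_forall fun x => ?_)
  rw [Complex.norm_exp_ofReal_mul_I]

/-- In an infinitesimal triangular array, the row sums of logarithms and of increments of
the factors are asymptotically equal. -/
theorem tendsto_sum_exp_sub_one_sub {f : ℕ → ℕ → ℝ → ℂ} {e : ℕ → ℕ → ℝ} {K S : ℝ} {ε : ℕ → ℝ}
    (hf : ∀ n k, Continuous (f n k)) (hf0 : ∀ n k, f n k 0 = 0) (hK0 : 0 ≤ K)
    (he0 : ∀ n k, 0 ≤ e n k)
    (hnear : ∀ n k, ∀ t ∈ Set.Icc (0 : ℝ) 1, ‖Complex.exp (f n k t) - 1‖ ≤ K * e n k)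
    (hε : Filter.Tendsto ε Filter.atTop (nhds 0))
    (hεle : ∀ n, ∀ k ∈ Finset.range (n + 1), e n k ≤ ε n)
    (hS : ∀ n, ∑ k ∈ Finset.range (n + 1), e n k ≤ S) :
    Filter.Tendsto (fun n => ∑ k ∈ Finset.range (n + 1), (Complex.exp (f n k 1) - 1)
      - ∑ k ∈ Finset.range (n + 1), f n k 1) Filter.atTop (nhds 0) := by
  have hsmall : ∀ᶠ n in Filter.atTop, K * ε n < 1 / 2 := by
    have := hε.const_mul K
    rw [mul_zero] at this
    exact this.eventually_lt_const (by norm_num)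
  have hz : Filter.Tendsto (fun n => K ^ 2 * ε n * S) Filter.atTop (nhds 0) := by
    simpa using (hε.const_mul (K ^ 2)).mul_const S
  refine squeeze_zero_norm' ?_ hz
  filter_upwards [hsmall] with n hn
  rw [← Finset.sum_sub_distrib]
  have hε0 : 0 ≤ ε n := (he0 n 0).trans (hεle n 0 (by simp))
  have hterm : ∀ k ∈ Finset.range (n + 1),
      ‖Complex.exp (f n k 1) - 1 - f n k 1‖ ≤ K ^ 2 * ε n * e n k := fun k hk => by
    have hle := hεle n k hk
    have he := he0 n k
    have hke : K * e n k ≤ K * ε n := by gcongr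
    have hlt : ∀ t ∈ Set.Icc (0 : ℝ) 1, ‖Complex.exp (f n k t) - 1‖ < 1 := fun t ht =>
      ((hnear n k t ht).trans hke).trans_lt (by linarith)
    -- Smallness on the whole path, not just at `t = 1`, excludes a multiple of `2πi` between `f`
    -- and the principal logarithm.
    have hlog := log_exp_eq_of_norm_exp_sub_one_lt (hf n k) (hf0 n k) hlt
    have h1 : ‖Complex.exp (f n k 1) - 1‖ ≤ K * e n k := hnear n k 1 ⟨zero_le_one, le_rfl⟩
    have h2 := norm_log_sub_le (z := Complex.exp (f n k 1)) (by linarith)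
    rw [hlog, norm_sub_rev] at h2
    refine h2.trans ?_
    -- One factor `e n k` is replaced by the vanishing row maximum, the other is kept for the
    -- bounded row sum.
    calc ‖Complex.exp (f n k 1) - 1‖ ^ 2 ≤ (K * e n k) ^ 2 := by gcongr
      _ = K ^ 2 * e n k * e n k := by ring
      _ ≤ K ^ 2 * ε n * e n k := by gcongr
  refine (norm_sum_le_of_le _ hterm).trans ?_
  rw [← Finset.mul_sum]
  gcongr
  exact hS n

/-- The increment `ψ(θ) - ψ(q⁻¹θ)` of the exponent of a selfdecomposable law is a limit of
exponents of shifted compound Poisson laws. -/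
theorem exists_tendsto_compound_poisson_exponent {ψ : EuclideanSpace ℝ ι → ℂ} (hψ : Continuous ψ)
    (h0 : ψ 0 = 0) (hre : ∀ θ, (ψ θ).re ≤ 0) {C : ℝ}
    (hC : ∀ θ, -(ψ θ).re ≤ C * (1 + ‖θ‖ ^ 2))
    (hsd : ∀ r : ℝ, 1 < r → ∃ V : Measure (EuclideanSpace ℝ ι), IsProbabilityMeasure V ∧
      ∀ θ, charFun V θ = Complex.exp (ψ θ - ψ (r⁻¹ • θ))) {q : ℝ} (hq : 1 < q) :
    ∃ (M : ℕ → Measure (EuclideanSpace ℝ ι)) (b : ℕ → EuclideanSpace ℝ ι),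
      (∀ n, IsFiniteMeasure (M n)) ∧ ∀ θ, Filter.Tendsto
        (fun n => charFun (M n) θ - charFun (M n) 0 + Complex.I * (⟪θ, b n⟫ : ℝ))
        Filter.atTop (nhds (ψ θ - ψ (q⁻¹ • θ))) := by
  have hq0 : 0 < q := one_pos.trans hq
  -- With `a = r⁻¹` this gives `a ^ (n + 1) = q⁻¹`, so the `n + 1` increments of row `n` telescope
  -- exactly to `ψ(θ) - ψ(q⁻¹θ)`.
  let r : ℕ → ℝ := fun n => q ^ ((n + 1 : ℝ)⁻¹)
  have hr1 : ∀ n, 1 < r n := fun n => Real.one_lt_rpow hq (by positivity)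
  have hr0 : ∀ n, 0 < r n := fun n => one_pos.trans (hr1 n)
  let a : ℕ → ℝ := fun n => (r n)⁻¹
  have ha0 : ∀ n, 0 < a n := fun n => inv_pos.2 (hr0 n)
  have ha1 : ∀ n, a n < 1 := fun n => inv_lt_one_of_one_lt₀ (hr1 n)
  have hpow : ∀ n, a n ^ (n + 1) = q⁻¹ := fun n => by
    simp only [a, r, inv_pow]
    rw [← Real.rpow_natCast, ← Real.rpow_mul hq0.le]
    push_cast
    rw [inv_mul_cancel₀ (by positivity), Real.rpow_one]
  have ha : Filter.Tendsto a Filter.atTop (nhds 1) := by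
    have h1 : Filter.Tendsto (fun n : ℕ => ((n : ℝ) + 1)⁻¹) Filter.atTop (nhds 0) := by
      simpa [one_div] using tendsto_one_div_add_atTop_nhds_zero_nat (𝕜 := ℝ)
    have h2 := (Real.continuous_const_rpow hq0.ne').tendsto 0 |>.comp h1
    rw [Real.rpow_zero] at h2
    simpa using h2.inv₀ one_ne_zero
  choose V hVp hV using fun n => hsd (r n) (hr1 n)
  let ρ : ℕ → ℕ → Measure (EuclideanSpace ℝ ι) := fun n k => (V n).map fun x => a n ^ k • x
  have hρp : ∀ n k, IsProbabilityMeasure (ρ n k) := fun n k =>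
    Measure.isProbabilityMeasure_map (by fun_prop)
  have hρ : ∀ n k θ, charFun (ρ n k) θ
      = Complex.exp (ψ (a n ^ k • θ) - ψ (a n ^ (k + 1) • θ)) := fun n k θ => by
    rw [charFun_map_smul, hV, smul_smul, ← pow_succ']
  obtain ⟨S, ε, hε, hεle, hS⟩ := exists_bound_array hψ hre hC ha0 ha1 ha hρ
  choose b hb using fun n k => exists_norm_charFun_map_sub_sub_one_le (ρ n k)
  have hρ'p : ∀ n k, IsProbabilityMeasure ((ρ n k).map fun x => x - b n k) := fun n k =>
    Measure.isProbabilityMeasure_map (by fun_prop)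
  -- The intensity is the sum of the centred factors, so its exponent is the row sum of `φ - 1`; the
  -- total shift restores the centring.
  refine ⟨fun n => ∑ k ∈ Finset.range (n + 1), (ρ n k).map fun x => x - b n k,
    fun n => ∑ k ∈ Finset.range (n + 1), b n k, fun n => inferInstance, fun θ => ?_⟩
  obtain ⟨K, hK⟩ : ∃ K : ℝ, K = (2 + 3 * Fintype.card ι) * (1 + ‖θ‖ ^ 2) := ⟨_, rfl⟩
  have hK0 : 0 ≤ K := by rw [hK]; positivity
  let e : ℕ → ℕ → ℝ := fun n k => ∫ p, min 1 (‖p.1 - p.2‖ ^ 2) ∂((ρ n k).prod (ρ n k))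
  have he0 : ∀ n k, 0 ≤ e n k := fun n k => integral_nonneg fun p => by positivity
  let f : ℕ → ℕ → ℝ → ℂ := fun n k t => ψ (a n ^ k • t • θ) - ψ (a n ^ (k + 1) • t • θ)
    - Complex.I * (⟪t • θ, b n k⟫ : ℝ)
  have hf : ∀ n k t, charFun ((ρ n k).map fun x => x - b n k) (t • θ)
      = Complex.exp (f n k t) := fun n k t => by
    simp only [sub_eq_add_neg _ (b n k)]
    rw [charFun_map_add_const, hρ, ← Complex.exp_add, real_inner_comm]
    congr 1
    simp only [f, inner_neg_right]
    push_cast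
    ring
  have hnear : ∀ n k, ∀ t ∈ Set.Icc (0 : ℝ) 1, ‖Complex.exp (f n k t) - 1‖ ≤ K * e n k :=
    fun n k t ht => by
    rw [← hf]
    refine (hb n k (t • θ)).trans ?_
    have h1 : ‖t • θ‖ ≤ ‖θ‖ := by
      rw [norm_smul, Real.norm_of_nonneg ht.1]
      exact mul_le_of_le_one_left (norm_nonneg _) ht.2
    have h3 : 1 + ‖t • θ‖ ^ 2 ≤ 1 + ‖θ‖ ^ 2 := by gcongr
    rw [hK]
    exact mul_le_mul_of_nonneg_right
      (mul_le_mul_of_nonneg_left h3 (by positivity)) (he0 n k)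
  have hsum : ∀ n, ψ θ - ψ (q⁻¹ • θ) = ∑ k ∈ Finset.range (n + 1), f n k 1
      + Complex.I * (⟪θ, ∑ k ∈ Finset.range (n + 1), b n k⟫ : ℝ) := fun n => by
    simp only [f, one_smul]
    rw [Finset.sum_sub_distrib, Finset.sum_range_sub' (fun k => ψ (a n ^ k • θ)), hpow, inner_sum,
      ← Finset.mul_sum]
    push_cast
    simp
  have hdiff := tendsto_sum_exp_sub_one_sub (fun n k => by fun_prop) (fun n k => by simp [f, h0])
    hK0 he0 hnear hε hεle hS
  refine (tendsto_iff_norm_sub_tendsto_zero.2 ?_)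
  refine (tendsto_zero_iff_norm_tendsto_zero.1 hdiff).congr fun n => ?_
  have hone : ∀ k, charFun ((ρ n k).map fun x => x - b n k) θ = Complex.exp (f n k 1) :=
    fun k => by rw [← hf, one_smul]
  have hzero : ∀ k, charFun ((ρ n k).map fun x => x - b n k) 0 = 1 := fun k => by
    rw [charFun_zero]; simp
  rw [hsum n, charFun_finsetSum, charFun_finsetSum]
  simp only [hone, hzero, Finset.sum_sub_distrib]
  congr 1
  ring

end TriangularArray

/-! ### Comparing measures locally and through densities -/

section MeasureComparison

variable {α : Type*} [MeasurableSpace α]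

theorem measure_le_of_subset_iUnion {I : Type*} [Countable I] {μ ν : Measure α} {S : I → Set α}
    (hS : ∀ i, MeasurableSet (S i))
    (h : ∀ i, ∀ A, MeasurableSet A → A ⊆ S i → μ A ≤ ν A) {A : Set α} (hA : MeasurableSet A)
    (hAS : A ⊆ ⋃ i, S i) : μ A ≤ ν A := by
  rcases isEmpty_or_nonempty I with hI | hI
  · rw [Set.iUnion_of_empty] at hAS
    simp [Set.subset_empty_iff.1 hAS]
  obtain ⟨f, hf⟩ := exists_surjective_nat I
  let T : ℕ → Set α := fun n => A ∩ disjointed (S ∘ f) n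
  have hTm : ∀ n, MeasurableSet (T n) := fun n =>
    hA.inter (MeasurableSet.disjointed (fun k => hS (f k)) n)
  have hTd : Pairwise (Function.onFun Disjoint T) := fun i j hij =>
    (disjoint_disjointed _ hij).mono Set.inter_subset_right Set.inter_subset_right
  have hAT : A = ⋃ n, T n := by
    rw [← Set.inter_iUnion, iUnion_disjointed, eq_comm, Set.inter_eq_left]
    refine hAS.trans fun x hx => ?_
    obtain ⟨i, hi⟩ := Set.mem_iUnion.1 hx
    obtain ⟨n, rfl⟩ := hf i
    exact Set.mem_iUnion.2 ⟨n, hi⟩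
  rw [hAT, measure_iUnion hTd hTm, measure_iUnion hTd hTm]
  exact ENNReal.tsum_le_tsum fun n => h (f n) _ (hTm n)
    (Set.inter_subset_right.trans (disjointed_subset _ n))

/-- Where `w` is neither zero nor infinite, a measure is recovered by integrating `w⁻¹` against its
weighted version, a monotone operation. The extra `κ` stands for the Gaussian atom at the origin. -/
theorem measure_le_of_withDensity_le {μ ν κ : Measure α} {w : α → ℝ≥0∞} (hw : Measurable w)
    (hle : μ.withDensity w ≤ κ + ν.withDensity w) {A : Set α} (hA : MeasurableSet A)
    (hw0 : ∀ x ∈ A, w x ≠ 0) (hwtop : ∀ x ∈ A, w x ≠ ∞) (hκ : κ A = 0) : μ A ≤ ν A := by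
  have key : ∀ σ : Measure α, σ A = ∫⁻ x in A, (w x)⁻¹ ∂(σ.withDensity w) := fun σ => by
    have h1 : (((σ.restrict A).withDensity w).withDensity fun x => (w x)⁻¹) = σ.restrict A :=
      withDensity_inv_same hw (ae_restrict_of_forall_mem hA hw0)
        (ae_restrict_of_forall_mem hA hwtop)
    rw [← restrict_withDensity hA] at h1
    have h2 := congrArg (fun τ : Measure α => τ A) h1
    simp only [Measure.restrict_apply_self] at h2
    rw [← h2, withDensity_apply _ hA, Measure.restrict_restrict hA, Set.inter_self]
  rw [key μ, key ν]
  refine (lintegral_mono' (Measure.restrict_mono le_rfl hle) le_rfl).trans ?_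
  rw [Measure.restrict_add, Measure.restrict_eq_zero.2 hκ, zero_add]

end MeasureComparison

/-! ### Finite-dimensional necessity -/

section Necessity

variable {ι : Type*} [Fintype ι] {ν : Measure (EuclideanSpace ℝ ι)}

theorem charFun_withDensity_ofReal (μ : Measure (EuclideanSpace ℝ ι))
    {w : EuclideanSpace ℝ ι → ℝ} (hw : Measurable w) (hw0 : ∀ x, 0 ≤ w x)
    (θ : EuclideanSpace ℝ ι) :
    charFun (μ.withDensity fun x => ENNReal.ofReal (w x)) θ
      = ∫ x, Complex.exp (Complex.I * (⟪θ, x⟫ : ℝ)) * (w x : ℂ) ∂μ := by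
  rw [charFun_apply, integral_withDensity_eq_integral_toReal_smul (by fun_prop)
    (Filter.Eventually.of_forall fun x => ENNReal.ofReal_lt_top)]
  congr 1
  ext x
  rw [ENNReal.toReal_ofReal (hw0 x), Complex.real_smul, mul_comm, real_inner_comm,
    mul_comm Complex.I]

theorem one_sub_cos_nonneg (y : ℝ) : 0 ≤ 1 - Real.cos y := by linarith [Real.cos_le_one y]

theorem IsLevyMeasure.integrable_exp_mul_one_sub_cos (hν : IsLevyMeasure ν)
    (θ η : EuclideanSpace ℝ ι) :
    Integrable (fun x => Complex.exp (Complex.I * (⟪θ, x⟫ : ℝ)) * ((1 - Real.cos ⟪η, x⟫ : ℝ) : ℂ))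
      ν := by
  simp only [← levyKernel_sub_half_add]
  exact (hν.integrable_levyKernel _).sub
    (((hν.integrable_levyKernel _).add (hν.integrable_levyKernel _)).div_const 2)

theorem IsLevyMeasure.integrable_one_sub_cos (hν : IsLevyMeasure ν) (η : EuclideanSpace ℝ ι) :
    Integrable (fun x => 1 - Real.cos ⟪η, x⟫) ν := by
  refine ((hν.integrable_exp_mul_one_sub_cos 0 η).re).congr
    (Filter.Eventually.of_forall fun x => ?_)
  simp only [inner_zero_left, Complex.ofReal_zero, mul_zero, Complex.exp_zero, one_mul]
  exact Complex.ofReal_re _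

theorem IsLevyMeasure.integral_exp_mul_one_sub_cos (hν : IsLevyMeasure ν)
    (θ η : EuclideanSpace ℝ ι) :
    ∫ x, Complex.exp (Complex.I * (⟪θ, x⟫ : ℝ)) * ((1 - Real.cos ⟪η, x⟫ : ℝ) : ℂ) ∂ν
      = ∫ x, levyKernel θ x ∂ν
        - (∫ x, levyKernel (θ + η) x ∂ν + ∫ x, levyKernel (θ - η) x ∂ν) / 2 := by
  have h1 := hν.integrable_levyKernel (θ + η)
  have h2 := hν.integrable_levyKernel (θ - η)
  simp only [← levyKernel_sub_half_add]
  have h3 : Integrable (fun x => (levyKernel (θ + η) x + levyKernel (θ - η) x) / 2) ν :=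
    (h1.add h2).div_const 2
  rw [integral_sub (hν.integrable_levyKernel _) h3, integral_div, integral_add h1 h2]

theorem integral_exp_mul_one_sub_cos (M : Measure (EuclideanSpace ℝ ι)) [IsFiniteMeasure M]
    (θ η : EuclideanSpace ℝ ι) :
    ∫ x, Complex.exp (Complex.I * (⟪θ, x⟫ : ℝ)) * ((1 - Real.cos ⟪η, x⟫ : ℝ) : ℂ) ∂M
      = charFun M θ - (charFun M (θ + η) + charFun M (θ - η)) / 2 := by
  have hint : ∀ θ : EuclideanSpace ℝ ι,
      Integrable (fun x => Complex.exp ((⟪x, θ⟫ : ℝ) * Complex.I)) M := fun θ =>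
    Integrable.of_bound (C := 1) (by fun_prop)
      (Filter.Eventually.of_forall fun x => (Complex.norm_exp_ofReal_mul_I _).le)
  have hint' : Integrable (fun x => (Complex.exp ((⟪x, θ + η⟫ : ℝ) * Complex.I)
      + Complex.exp ((⟪x, θ - η⟫ : ℝ) * Complex.I)) / 2) M :=
    ((hint _).add (hint _)).div_const 2
  simp only [charFun_apply]
  rw [← integral_add (hint _) (hint _), ← integral_div, ← integral_sub (hint _) hint']
  congr 1
  ext x
  have h1 := levyKernel_sub_half_add θ η x
  simp only [levyKernel, inner_add_right, inner_sub_right, inner_add_left, inner_sub_left] at h1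
  rw [← h1]
  simp only [inner_add_right, inner_sub_right, real_inner_comm x, mul_comm Complex.I]
  push_cast
  ring

theorem quadForm_add_add_sub (B : Matrix ι ι ℝ) (θ η : EuclideanSpace ℝ ι) :
    (θ + η).ofLp ⬝ᵥ B.mulVec (θ + η).ofLp + (θ - η).ofLp ⬝ᵥ B.mulVec (θ - η).ofLp
      = 2 * (θ.ofLp ⬝ᵥ B.mulVec θ.ofLp) + 2 * (η.ofLp ⬝ᵥ B.mulVec η.ofLp) := by
  simp only [WithLp.ofLp_add, WithLp.ofLp_sub, Matrix.mulVec_add, Matrix.mulVec_sub,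
    dotProduct_add, add_dotProduct, dotProduct_sub, sub_dotProduct]
  ring

theorem quadForm_smul (B : Matrix ι ι ℝ) (c : ℝ) (θ : EuclideanSpace ℝ ι) :
    (c • θ).ofLp ⬝ᵥ B.mulVec (c • θ).ofLp = c ^ 2 * (θ.ofLp ⬝ᵥ B.mulVec θ.ofLp) := by
  simp only [WithLp.ofLp_smul, Matrix.mulVec_smul, dotProduct_smul, smul_dotProduct, smul_eq_mul]
  ring

/-- Drift and truncation are linear in `θ` and cancel. The quadratic form leaves a constant in `θ`,
the transform of an atom at `0`, while the jumps leave the transform of a finite weighted measure.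
-/
theorem levyKhintchineExponent_sub_half_add (hν : IsLevyMeasure ν) (γ : EuclideanSpace ℝ ι)
    (B : Matrix ι ι ℝ) (θ η : EuclideanSpace ℝ ι) :
    levyKhintchineExponent γ B ν θ
        - (levyKhintchineExponent γ B ν (θ + η) + levyKhintchineExponent γ B ν (θ - η)) / 2
      = ((1 / 2 * (η.ofLp ⬝ᵥ B.mulVec η.ofLp) : ℝ) : ℂ)
        + ∫ x, Complex.exp (Complex.I * (⟪θ, x⟫ : ℝ)) * ((1 - Real.cos ⟪η, x⟫ : ℝ) : ℂ) ∂ν := by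
  have h1 := congrArg (fun y : ℝ => (y : ℂ)) (quadForm_add_add_sub B θ η)
  rw [hν.integral_exp_mul_one_sub_cos]
  simp only [levyKhintchineExponent_eq, inner_add_left, inner_sub_left]
  push_cast at h1 ⊢
  linear_combination (1 / 4 : ℂ) * h1

/-- The key comparison: after weighting by `1 - cos⟪η, x⟫`, the scaled Lévy measure of a
selfdecomposable law is dominated by the Lévy measure, up to an atom at the origin. -/
theorem withDensity_map_smul_le (hν : IsLevyMeasure ν) {γ : EuclideanSpace ℝ ι}
    {B : Matrix ι ι ℝ} (hB : B.PosSemidef) {q : ℝ} (hq : 1 < q)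
    {M : ℕ → Measure (EuclideanSpace ℝ ι)} {b : ℕ → EuclideanSpace ℝ ι}
    (hM : ∀ n, IsFiniteMeasure (M n))
    (hlim : ∀ θ, Filter.Tendsto
      (fun n => charFun (M n) θ - charFun (M n) 0 + Complex.I * (⟪θ, b n⟫ : ℝ))
      Filter.atTop
      (nhds (levyKhintchineExponent γ B ν θ - levyKhintchineExponent γ B ν (q⁻¹ • θ))))
    (η : EuclideanSpace ℝ ι) :
    (ν.map fun x => q⁻¹ • x).withDensity (fun x => ENNReal.ofReal (1 - Real.cos ⟪η, x⟫))
      ≤ ENNReal.ofReal (1 / 2 * (1 - q⁻¹ ^ 2) * (η.ofLp ⬝ᵥ B.mulVec η.ofLp)) • Measure.dirac 0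
        + ν.withDensity (fun x => ENNReal.ofReal (1 - Real.cos ⟪η, x⟫)) := by
  set c := 1 / 2 * (1 - q⁻¹ ^ 2) * (η.ofLp ⬝ᵥ B.mulVec η.ofLp) with hc
  have hq1 : q⁻¹ ^ 2 ≤ 1 := pow_le_one₀ (by positivity) (inv_le_one_of_one_le₀ hq.le)
  have hc0 : 0 ≤ c := by
    have := hB.dotProduct_mulVec_nonneg η.ofLp
    simp only [star_trivial] at this
    exact mul_nonneg (by linarith) this
  set W : EuclideanSpace ℝ ι → ℝ≥0∞ := fun x => ENNReal.ofReal (1 - Real.cos ⟪η, x⟫) with hW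
  have hwm : Measurable fun x : EuclideanSpace ℝ ι => 1 - Real.cos ⟪η, x⟫ := by fun_prop
  have hinner : ∀ (y x : EuclideanSpace ℝ ι), ⟪y, q⁻¹ • x⟫ = ⟪q⁻¹ • y, x⟫ := fun y x => by
    rw [inner_smul_right, inner_smul_left]; rfl
  have hfin : IsFiniteMeasure (ν.withDensity W) :=
    isFiniteMeasure_withDensity_ofReal (hν.integrable_one_sub_cos η).hasFiniteIntegral
  have hfin' : IsFiniteMeasure ((ν.map fun x => q⁻¹ • x).withDensity W) := by
    refine isFiniteMeasure_withDensity_ofReal (Integrable.hasFiniteIntegral ?_)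
    rw [integrable_map_measure hwm.aestronglyMeasurable (by fun_prop)]
    simpa only [Function.comp_def, hinner] using hν.integrable_one_sub_cos (q⁻¹ • η)
  have hfinM : ∀ n, IsFiniteMeasure ((M n).withDensity W) := fun n => by
    refine isFiniteMeasure_withDensity_ofReal (Integrable.hasFiniteIntegral ?_)
    refine Integrable.of_bound (C := 2) hwm.aestronglyMeasurable
      (Filter.Eventually.of_forall fun x => ?_)
    rw [Real.norm_of_nonneg (one_sub_cos_nonneg _)]
    linarith [Real.neg_one_le_cos ⟪η, x⟫]
  have hfind : IsFiniteMeasure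
      (ENNReal.ofReal c • (Measure.dirac 0 : Measure (EuclideanSpace ℝ ι))) :=
    Measure.smul_finite _ ENNReal.ofReal_ne_top
  -- The scaled Lévy measure is moved to the approximating side, so only positive measures occur:
  -- the weighted `M n` is positive, whence the sum dominates the scaled measure for each `n`.
  refine measure_le_of_tendsto_charFun
    (μ := fun n => (M n).withDensity W + (ν.map fun x => q⁻¹ • x).withDensity W)
    (fun θ => ?_) fun n => Measure.le_add_left le_rfl
  have hadd : ∀ (μ₁ μ₂ : Measure (EuclideanSpace ℝ ι)) [IsFiniteMeasure μ₁] [IsFiniteMeasure μ₂],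
      charFun (μ₁ + μ₂) θ = charFun μ₁ θ + charFun μ₂ θ := fun μ₁ μ₂ _ _ => by
    simp only [charFun_apply]
    refine integral_add_measure ?_ ?_ <;>
    exact Integrable.of_bound (C := 1) (by fun_prop)
      (Filter.Eventually.of_forall fun x => (Complex.norm_exp_ofReal_mul_I _).le)
  have hdirac : charFun (ENNReal.ofReal c • (Measure.dirac 0 : Measure (EuclideanSpace ℝ ι))) θ
      = c := by
    rw [charFun_apply, integral_smul_measure, ENNReal.toReal_ofReal hc0]
    simp
  simp only [hadd, hdirac, hW, charFun_withDensity_ofReal _ hwm fun x => one_sub_cos_nonneg _]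
  have hmap : ∫ x, Complex.exp (Complex.I * (⟪θ, x⟫ : ℝ)) * ((1 - Real.cos ⟪η, x⟫ : ℝ) : ℂ)
        ∂(ν.map fun x => q⁻¹ • x)
      = ∫ x, Complex.exp (Complex.I * (⟪q⁻¹ • θ, x⟫ : ℝ))
        * ((1 - Real.cos ⟪q⁻¹ • η, x⟫ : ℝ) : ℂ) ∂ν := by
    rw [integral_map (by fun_prop) (by fun_prop)]
    simp only [hinner]
  -- The same second difference cancels the shifts `b n`, about whose convergence nothing is known.
  have hL := (hlim θ).sub (((hlim (θ + η)).add (hlim (θ - η))).div_const 2)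
  have h1 := levyKhintchineExponent_sub_half_add hν γ B θ η
  have h2 := levyKhintchineExponent_sub_half_add hν γ B (q⁻¹ • θ) (q⁻¹ • η)
  rw [quadForm_smul, ← hmap] at h2
  have h3 : levyKhintchineExponent γ B ν θ - levyKhintchineExponent γ B ν (q⁻¹ • θ)
      - (levyKhintchineExponent γ B ν (θ + η) - levyKhintchineExponent γ B ν (q⁻¹ • (θ + η))
        + (levyKhintchineExponent γ B ν (θ - η)
          - levyKhintchineExponent γ B ν (q⁻¹ • (θ - η)))) / 2
      = (c + ∫ x, Complex.exp (Complex.I * (⟪θ, x⟫ : ℝ))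
          * ((1 - Real.cos ⟪η, x⟫ : ℝ) : ℂ) ∂ν)
        - ∫ x, Complex.exp (Complex.I * (⟪θ, x⟫ : ℝ)) * ((1 - Real.cos ⟪η, x⟫ : ℝ) : ℂ)
          ∂(ν.map fun x => q⁻¹ • x) := by
    rw [smul_add, smul_sub, hc]
    push_cast at h1 h2 ⊢
    linear_combination h1 - h2
  rw [h3] at hL
  have h4 := hL.add_const (∫ x, Complex.exp (Complex.I * (⟪θ, x⟫ : ℝ))
    * ((1 - Real.cos ⟪η, x⟫ : ℝ) : ℂ) ∂(ν.map fun x => q⁻¹ • x))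
  rw [sub_add_cancel] at h4
  refine h4.congr fun n => ?_
  rw [integral_exp_mul_one_sub_cos (M n)]
  simp only [inner_add_left, inner_sub_left]
  push_cast
  ring

/-- The Lévy measure of a selfdecomposable law on Euclidean space shrinks under dilations. -/
theorem IsCharacteristicTriplet.map_smul_le {μ : Measure (EuclideanSpace ℝ ι)}
    [IsProbabilityMeasure μ] {γ : EuclideanSpace ℝ ι} {B : Matrix ι ι ℝ}
    (hT : IsCharacteristicTriplet μ γ B ν)
    (hsd : ∀ r : ℝ, 1 < r → ∃ V : Measure (EuclideanSpace ℝ ι), IsProbabilityMeasure V ∧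
      ∀ θ, charFun μ θ = charFun μ (r⁻¹ • θ) * charFun V θ) {q : ℝ} (hq : 1 < q) :
    (ν.map fun x => q⁻¹ • x) ≤ ν := by
  have hν := hT.isLevyMeasure
  obtain ⟨C, -, hC⟩ := hν.exists_neg_re_levyKhintchineExponent_le γ B
  have hre : ∀ θ, (levyKhintchineExponent γ B ν θ).re ≤ 0 := fun θ => by
    have := norm_charFun_le_one (μ := μ) θ
    rwa [hT.charFun_eq, Complex.norm_exp, Real.exp_le_one_iff] at this
  obtain ⟨M, b, hM, hlim⟩ := exists_tendsto_compound_poisson_exponent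
    (hν.continuous_levyKhintchineExponent γ B) (levyKhintchineExponent_zero γ B ν) hre hC
    (fun r hr => by
      obtain ⟨V, hV, hVeq⟩ := hsd r hr
      refine ⟨V, hV, fun θ => ?_⟩
      rw [Complex.exp_sub, ← hT.charFun_eq, ← hT.charFun_eq, hVeq θ, mul_div_cancel_left₀]
      rw [hT.charFun_eq]
      exact Complex.exp_ne_zero _) hq
  have hw := withDensity_map_smul_le hν hT.posSemidef hq hM hlim
  have hqm : Measurable fun x : EuclideanSpace ℝ ι => q⁻¹ • x := by fun_prop
  refine Measure.le_iff.2 fun A hA => ?_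
  have h0 : (ν.map fun x => q⁻¹ • x) {0} = 0 := by
    rw [Measure.map_apply hqm (measurableSet_singleton 0)]
    convert hν.measure_zero using 2
    ext x
    simp [(one_pos.trans hq).ne']
  rw [← measure_sdiff_null h0, ← measure_sdiff_null hν.measure_zero]
  -- These countably many sets cover the complement of the origin. On each, a frequency along
  -- coordinate `p.1` of size `1/(p.2 + 1)` keeps `⟪η, x⟫` nonzero and inside `(-1, 1)`, where `1 -
  -- cos` is positive.
  let S : ι × ℕ → Set (EuclideanSpace ℝ ι) := fun p => {x | x p.1 ≠ 0 ∧ |x p.1| < (p.2 + 1 : ℕ)}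
  refine measure_le_of_subset_iUnion (S := S) (fun p => ?_) (fun p A' hA' hA'S => ?_)
    (hA.diff (measurableSet_singleton 0)) fun x hx => ?_
  · have hm : Measurable fun x : EuclideanSpace ℝ ι => x p.1 := by fun_prop
    exact (hm (measurableSet_singleton 0)).compl.inter
      (measurableSet_lt hm.abs measurable_const)
  · classical
    let η : EuclideanSpace ℝ ι := EuclideanSpace.single p.1 ((p.2 + 1 : ℕ) : ℝ)⁻¹
    refine measure_le_of_withDensity_le
      (w := fun x => ENNReal.ofReal (1 - Real.cos ⟪η, x⟫)) (by fun_prop) (hw η) hA' (fun x hx => ?_)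
      (fun x _ => ENNReal.ofReal_ne_top) ?_
    · obtain ⟨hx0, hxlt⟩ := hA'S hx
      have hN : (0 : ℝ) < (p.2 + 1 : ℕ) := by positivity
      have hη : ⟪η, x⟫ = ((p.2 + 1 : ℕ) : ℝ)⁻¹ * x p.1 := by
        simp only [η, EuclideanSpace.inner_single_left]
        rfl
      rw [hη, ne_eq, ENNReal.ofReal_eq_zero, not_le, sub_pos]
      have hlt : |((p.2 + 1 : ℕ) : ℝ)⁻¹ * x p.1| < 1 := by
        rw [abs_mul, abs_of_pos (inv_pos.2 hN), inv_mul_lt_one₀ hN]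
        exact hxlt
      refine lt_of_le_of_ne (Real.cos_le_one _) fun hcos => ?_
      have hpi := Real.pi_gt_three
      obtain ⟨h5, h6⟩ := abs_lt.1 hlt
      rw [Real.cos_eq_one_iff_of_lt_of_lt (by linarith) (by linarith)] at hcos
      exact hx0 ((mul_eq_zero.1 hcos).resolve_left (inv_ne_zero hN.ne'))
    · have hnot : (0 : EuclideanSpace ℝ ι) ∉ A' := fun h => (hA'S h).1 rfl
      simp [Measure.dirac_apply' _ hA', hnot]
  · have hne : x ≠ 0 := hx.2
    obtain ⟨i, hi⟩ : ∃ i, x i ≠ 0 := by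
      by_contra hall
      push Not at hall
      exact hne (by ext i; exact hall i)
    obtain ⟨m, hm⟩ := exists_nat_gt |x i|
    refine Set.mem_iUnion.2 ⟨(i, m), hi, hm.trans_le ?_⟩
    push_cast
    linarith

end Necessity

/-! ### Finite-dimensional sufficiency -/

section Existence

theorem exists_charFun_eq_pow {E : Type*} [NormedAddCommGroup E] [InnerProductSpace ℝ E]
    [MeasurableSpace E] [BorelSpace E] [SecondCountableTopology E] (μ : Measure E)
    [IsProbabilityMeasure μ] (n : ℕ) :
    ∃ ρ : Measure E, IsProbabilityMeasure ρ ∧ ∀ t, charFun ρ t = charFun μ t ^ n := by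
  induction n with
  | zero => exact ⟨Measure.dirac 0, inferInstance, fun t => by simp [charFun_dirac]⟩
  | succ n ih =>
    obtain ⟨ρ, hρ, h⟩ := ih
    exact ⟨ρ.conv μ, inferInstance, fun t => by rw [charFun_conv, h, pow_succ]⟩

/-- Compound Poisson laws. -/
theorem exists_charFun_eq_exp_charFun_sub {E : Type*} [NormedAddCommGroup E]
    [InnerProductSpace ℝ E] [FiniteDimensional ℝ E] [MeasurableSpace E] [BorelSpace E]
    (κ : Measure E) [IsFiniteMeasure κ] :
    ∃ ρ : Measure E, IsProbabilityMeasure ρ ∧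
      ∀ t, charFun ρ t = Complex.exp (charFun κ t - charFun κ 0) := by
  -- Starting the index beyond the total mass makes the weight of the atom at `0` in `p n`
  -- nonnegative for every `n`; the powers of `p n` then converge by `(1 + z/N)^N → exp z`.
  obtain ⟨N₀, hN₀⟩ := exists_nat_gt (κ.real Set.univ)
  have hN : ∀ n : ℕ, κ.real Set.univ < (n + N₀ : ℕ) := fun n =>
    hN₀.trans_le (by exact_mod_cast Nat.le_add_left _ _)
  have hNpos : ∀ n : ℕ, (0 : ℝ) < (n + N₀ : ℕ) := fun n => measureReal_nonneg.trans_lt (hN n)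
  let p : ℕ → Measure E := fun n =>
    ENNReal.ofReal (1 - κ.real Set.univ / (n + N₀ : ℕ)) • Measure.dirac 0
      + ENNReal.ofReal ((n + N₀ : ℕ) : ℝ)⁻¹ • κ
  have hle : ∀ n, 0 ≤ 1 - κ.real Set.univ / (n + N₀ : ℕ) := fun n =>
    sub_nonneg.2 ((div_le_one (hNpos n)).2 (hN n).le)
  have hp : ∀ n, IsProbabilityMeasure (p n) := fun n => ⟨by
    have h1 : κ Set.univ = ENNReal.ofReal (κ.real Set.univ) := (ofReal_measureReal).symm
    simp only [p, Measure.add_apply, Measure.smul_apply, measure_univ, smul_eq_mul, mul_one]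
    rw [h1, ← ENNReal.ofReal_mul (inv_nonneg.2 (hNpos n).le),
      ← ENNReal.ofReal_add (hle n) (by have := hNpos n; positivity), div_eq_inv_mul, sub_add_cancel,
      ENNReal.ofReal_one]⟩
  have hchar : ∀ n t, charFun (p n) t = 1 + (charFun κ t - charFun κ 0) / (n + N₀ : ℕ) :=
    fun n t => by
    have hint : ∀ (m : Measure E) [IsFiniteMeasure m],
        Integrable (fun x => Complex.exp ((⟪x, t⟫ : ℝ) * Complex.I)) m := fun m _ =>
      Integrable.of_bound (C := 1) (by fun_prop)
        (Filter.Eventually.of_forall fun x => (Complex.norm_exp_ofReal_mul_I _).le)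
    rw [charFun_zero, charFun_apply, charFun_apply,
      integral_add_measure ((hint _).smul_measure ENNReal.ofReal_ne_top)
        ((hint κ).smul_measure ENNReal.ofReal_ne_top),
      integral_smul_measure, integral_smul_measure, ENNReal.toReal_ofReal (hle n),
      ENNReal.toReal_ofReal (inv_nonneg.2 (hNpos n).le), integral_dirac]
    simp only [inner_zero_left, Complex.ofReal_zero, zero_mul, Complex.exp_zero, Complex.real_smul]
    push_cast
    ring
  choose ρ hρ hρchar using fun n => exists_charFun_eq_pow (p n) (n + N₀)
  refine exists_charFun_eq_of_tendsto (μ := ρ) (Continuous.continuousAt (by fun_prop)) fun t => ?_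
  simp only [hρchar, hchar]
  exact (Complex.tendsto_one_add_div_pow_exp (charFun κ t - charFun κ 0)).comp
    (Filter.tendsto_add_atTop_nat N₀)

variable {ι : Type*} [Fintype ι] {ν : Measure (EuclideanSpace ℝ ι)}

theorem exists_charFun_eq_exp_gaussian (m : EuclideanSpace ℝ ι) {B : Matrix ι ι ℝ}
    (hB : B.PosSemidef) :
    ∃ ρ : Measure (EuclideanSpace ℝ ι), IsProbabilityMeasure ρ ∧ ∀ θ, charFun ρ θ
      = Complex.exp (Complex.I * (⟪θ, m⟫ : ℝ)
        - ((1 / 2 * (θ.ofLp ⬝ᵥ B.mulVec θ.ofLp) : ℝ) : ℂ)) := by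
  classical
  refine ⟨multivariateGaussian m B, inferInstance, fun θ => ?_⟩
  rw [charFun_multivariateGaussian hB]
  push_cast
  ring_nf

/-- For finite `M` the compensator is integrable by itself and splits off as a drift, leaving a
compound Poisson exponent. -/
theorem integral_levyKernel_eq (M : Measure (EuclideanSpace ℝ ι)) [IsFiniteMeasure M]
    (θ : EuclideanSpace ℝ ι) :
    ∫ x, levyKernel θ x ∂M
      = charFun M θ - charFun M 0 - Complex.I * (⟪θ, ∫ x, levyTruncation x ∂M⟫ : ℝ) := by
  have hτ : Integrable (fun x : EuclideanSpace ℝ ι => levyTruncation x) M := by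
    refine Integrable.of_bound (C := 1 + Fintype.card ι)
      (Measurable.aestronglyMeasurable (by fun_prop)) (Filter.Eventually.of_forall fun x => ?_)
    have h1 := norm_levyTruncation_sq_le x
    have h2 : min 1 (‖x‖ ^ 2) ≤ 1 := min_le_left _ _
    have hd : (0 : ℝ) ≤ Fintype.card ι := Nat.cast_nonneg _
    nlinarith [norm_nonneg (levyTruncation x), sq_nonneg (‖levyTruncation x‖ - 1)]
  have h1 : Integrable (fun x => Complex.exp (Complex.I * (⟪θ, x⟫ : ℝ))) M :=
    Integrable.of_bound (C := 1) (by fun_prop)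
      (Filter.Eventually.of_forall fun x => (Complex.norm_exp_I_mul_ofReal _).le)
  have h2 : Integrable (fun x => Complex.exp (Complex.I * (⟪θ, x⟫ : ℝ)) - 1) M :=
    h1.sub (integrable_const _)
  have h3 : Integrable (fun x => Complex.I * ((⟪levyTruncation x, θ⟫ : ℝ) : ℂ)) M :=
    (hτ.inner_const θ).ofReal.const_mul _
  unfold levyKernel
  rw [integral_sub h2 h3, integral_sub h1 (integrable_const _), integral_const_mul,
    integral_complex_ofReal, charFun_zero, charFun_apply, ← integral_inner hτ]
  simp [real_inner_comm, mul_comm Complex.I]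

theorem IsLevyMeasure.measure_lt_norm_lt_top (hν : IsLevyMeasure ν) {ε : ℝ} (hε : 0 < ε) :
    ν {x | ε < ‖x‖} < ∞ := by
  have h1 := hν.integrable_min_one_sq.measure_ge_lt_top (ε := min 1 (ε ^ 2)) (by positivity)
  refine (measure_mono fun x hx => ?_).trans_lt h1
  have hx' : ε < ‖x‖ := hx
  have h2 : ε ^ 2 ≤ ‖x‖ ^ 2 := by gcongr
  exact min_le_min_left 1 h2

theorem IsLevyMeasure.tendsto_setIntegral_levyKernel (hν : IsLevyMeasure ν) {c : ℝ} (hc : 0 < c)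
    (θ : EuclideanSpace ℝ ι) :
    Filter.Tendsto (fun n : ℕ => ∫ x in {x | c * (n + 1 : ℝ)⁻¹ < ‖x‖}, levyKernel θ x ∂ν)
      Filter.atTop (nhds (∫ x, levyKernel θ x ∂ν)) := by
  let S : ℕ → Set (EuclideanSpace ℝ ι) := fun n => {x | c * (n + 1 : ℝ)⁻¹ < ‖x‖}
  have hmono : Monotone S := fun m n hmn x hx => by
    have hx' : c * (m + 1 : ℝ)⁻¹ < ‖x‖ := hx
    refine lt_of_le_of_lt ?_ hx'
    gcongr
  have h1 := tendsto_setIntegral_of_monotone (μ := ν) (f := levyKernel θ) (s := S)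
    (fun n => measurableSet_lt measurable_const measurable_norm) hmono
    (hν.integrable_levyKernel θ).integrableOn
  rwa [setIntegral_eq_integral_of_forall_compl_eq_zero fun x hx => ?_] at h1
  have hx0 : x = 0 := by
    by_contra hne
    obtain ⟨n, hn⟩ := exists_nat_one_div_lt (div_pos (norm_pos_iff.2 hne) hc)
    rw [one_div, lt_div_iff₀' hc] at hn
    exact hx (Set.mem_iUnion.2 ⟨n, hn⟩)
  rw [hx0, levyKernel_zero_right]

/-- If the Lévy measure shrinks under the dilation by `q`, then the quotient of characteristic
functions required by selfdecomposability is a characteristic function. -/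
theorem exists_charFun_eq_exp_sub (hν : IsLevyMeasure ν) (γ : EuclideanSpace ℝ ι)
    {B : Matrix ι ι ℝ} (hB : B.PosSemidef) {q : ℝ} (hq : 1 < q)
    (hle : (ν.map fun x => q⁻¹ • x) ≤ ν) :
    ∃ ρ : Measure (EuclideanSpace ℝ ι), IsProbabilityMeasure ρ ∧ ∀ θ, charFun ρ θ
      = Complex.exp (levyKhintchineExponent γ B ν θ - levyKhintchineExponent γ B ν (q⁻¹ • θ)) := by
  have hq0 : 0 < q := one_pos.trans hq
  have hq1 : q⁻¹ ^ 2 ≤ 1 := pow_le_one₀ (by positivity) (inv_le_one_of_one_le₀ hq.le)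
  have hqm : Measurable fun x : EuclideanSpace ℝ ι => q⁻¹ • x := by fun_prop
  -- Dilation by `q⁻¹` carries `S q n` onto `S 1 n`, so cutting the scaled measure at `1/(n + 1)`
  -- amounts to cutting `ν` at `q/(n + 1)`.
  let S : ℝ → ℕ → Set (EuclideanSpace ℝ ι) := fun c n => {x | c * (n + 1 : ℝ)⁻¹ < ‖x‖}
  have hSm : ∀ c n, MeasurableSet (S c n) := fun c n =>
    measurableSet_lt measurable_const measurable_norm
  have hSfin : ∀ c n, 0 < c → IsFiniteMeasure (ν.restrict (S c n)) := fun c n hc =>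
    ⟨by
      rw [Measure.restrict_apply_univ]
      exact hν.measure_lt_norm_lt_top (by positivity)⟩
  have hf1 : ∀ n, IsFiniteMeasure (ν.restrict (S 1 n)) := fun n => hSfin 1 n one_pos
  have hfq : ∀ n, IsFiniteMeasure (ν.restrict (S q n)) := fun n => hSfin q n hq0
  have hmap : ∀ n, (ν.map fun x => q⁻¹ • x).restrict (S 1 n)
      = (ν.restrict (S q n)).map fun x => q⁻¹ • x := fun n => by
    rw [Measure.restrict_map hqm (hSm 1 n)]
    congr 2
    ext x
    simp only [S, Set.mem_preimage, Set.mem_ofPred_eq, norm_smul, Real.norm_eq_abs, abs_inv,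
      abs_of_pos hq0, one_mul]
    rw [lt_inv_mul_iff₀ hq0]
  let σ : ℕ → Measure (EuclideanSpace ℝ ι) := fun n => (ν.restrict (S q n)).map fun x => q⁻¹ • x
  have hσ : ∀ n, IsFiniteMeasure (σ n) := fun n => inferInstance
  have hσle : ∀ n, σ n ≤ ν.restrict (S 1 n) := fun n => by
    simp only [σ, ← hmap n]
    exact Measure.restrict_mono le_rfl hle
  -- Here the shrinking hypothesis is used: by `hσle` this truncated subtraction is a genuine
  -- difference.
  let κ : ℕ → Measure (EuclideanSpace ℝ ι) := fun n => ν.restrict (S 1 n) - σ n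
  have hκ : ∀ n θ, charFun (κ n) θ = charFun (ν.restrict (S 1 n)) θ - charFun (σ n) θ :=
    fun n θ => by
    have h1 : κ n + σ n = ν.restrict (S 1 n) := Measure.sub_add_cancel_of_le (hσle n)
    have hint : ∀ (m : Measure (EuclideanSpace ℝ ι)) [IsFiniteMeasure m],
        Integrable (fun x => Complex.exp ((⟪x, θ⟫ : ℝ) * Complex.I)) m := fun m _ =>
      Integrable.of_bound (C := 1) (by fun_prop)
        (Filter.Eventually.of_forall fun x => (Complex.norm_exp_ofReal_mul_I _).le)
    rw [← h1, eq_sub_iff_add_eq]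
    simp only [charFun_apply]
    exact (integral_add_measure (hint _) (hint _)).symm
  let d : ℕ → EuclideanSpace ℝ ι := fun n =>
    ∫ x in S 1 n, levyTruncation x ∂ν - q⁻¹ • ∫ x in S q n, levyTruncation x ∂ν
  have hκeq : ∀ n θ, charFun (κ n) θ - charFun (κ n) 0
      = ∫ x in S 1 n, levyKernel θ x ∂ν - ∫ x in S q n, levyKernel (q⁻¹ • θ) x ∂ν
        + Complex.I * (⟪θ, d n⟫ : ℝ) := fun n θ => by
    rw [hκ, hκ, integral_levyKernel_eq (ν.restrict (S 1 n)),
      integral_levyKernel_eq (ν.restrict (S q n))]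
    simp only [σ, charFun_map_smul, smul_zero, d, inner_sub_right, inner_smul_right,
      real_inner_smul_left]
    push_cast
    ring
  -- The mean cancels the drift `d n` produced by uncompensating the truncated jumps.
  choose G hG hGchar using fun n => exists_charFun_eq_exp_gaussian ((1 - q⁻¹) • γ - d n)
    (hB.smul (show 0 ≤ 1 - q⁻¹ ^ 2 by linarith))
  choose Q hQ hQchar using fun n => exists_charFun_eq_exp_charFun_sub (κ n)
  have hcont := hν.continuous_levyKhintchineExponent γ B
  refine exists_charFun_eq_of_tendsto (μ := fun n => (G n).conv (Q n))
    (Continuous.continuousAt (by fun_prop)) fun θ => ?_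
  have hlim := (hν.tendsto_setIntegral_levyKernel one_pos θ).sub
    (hν.tendsto_setIntegral_levyKernel hq0 (q⁻¹ • θ))
  have hlim' := (Complex.continuous_exp.tendsto _).comp (hlim.const_add
    (Complex.I * (⟪θ, (1 - q⁻¹) • γ⟫ : ℝ)
      - ((1 / 2 * ((1 - q⁻¹ ^ 2) * (θ.ofLp ⬝ᵥ B.mulVec θ.ofLp)) : ℝ) : ℂ)))
  have hval : Complex.I * (⟪θ, (1 - q⁻¹) • γ⟫ : ℝ)
      - ((1 / 2 * ((1 - q⁻¹ ^ 2) * (θ.ofLp ⬝ᵥ B.mulVec θ.ofLp)) : ℝ) : ℂ)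
      + (∫ x, levyKernel θ x ∂ν - ∫ x, levyKernel (q⁻¹ • θ) x ∂ν)
      = levyKhintchineExponent γ B ν θ - levyKhintchineExponent γ B ν (q⁻¹ • θ) := by
    rw [levyKhintchineExponent_eq, levyKhintchineExponent_eq, quadForm_smul, inner_smul_right,
      real_inner_smul_left]
    push_cast
    ring
  rw [hval] at hlim'
  refine hlim'.congr fun n => ?_
  rw [charFun_conv, hGchar, hQchar, ← Complex.exp_add, hκeq, Function.comp_apply]
  congr 1
  simp only [inner_sub_right, Matrix.smul_mulVec, dotProduct_smul, smul_eq_mul, S]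
  push_cast
  ring

end Existence

/-! ### From cylinders to the cylindrical σ-algebra -/

section CylinderComparison

variable {U : Type u}

@[fun_prop]
theorem measurable_finProj (s : Finset U) : Measurable (finProj s) := by
  unfold finProj
  fun_prop

/-- Finite measures on a product are compared by their values on measurable cylinders. -/
theorem measure_le_of_forall_cylinder_le {μ ν : Measure (U → ℝ)} [IsFiniteMeasure μ]
    [IsFiniteMeasure ν] (h : ∀ C ∈ measurableCylinders fun _ : U => ℝ, μ C ≤ ν C) : μ ≤ ν := by
  refine Measure.le_iff.2 fun A hA => ENNReal.le_of_forall_pos_le_add fun ε hε _ => ?_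
  have hε2 : (0 : ℝ≥0∞) < (ε / 2 : NNReal) := by exact_mod_cast half_pos hε
  -- Approximating with respect to `μ + ν` yields one cylinder that is good for both measures.
  obtain ⟨C, hC, hCA⟩ := exists_measure_symmDiff_lt_of_generateFrom_isSetRing (μ := μ + ν)
    isSetRing_measurableCylinders
    ⟨{Set.univ}, Set.countable_singleton _,
      Set.singleton_subset_iff.2 (univ_mem_measurableCylinders _), by simp⟩
    generateFrom_measurableCylinders.symm hA hε2
  rw [Measure.add_apply] at hCA
  have hμ : μ A ≤ μ C + μ (symmDiff C A) := by
    refine (measure_mono fun x hx => ?_).trans (measure_union_le _ _)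
    by_cases hxC : x ∈ C
    · exact Or.inl hxC
    · exact Or.inr (Or.inr ⟨hx, hxC⟩)
  have hν : ν C ≤ ν A + ν (symmDiff C A) := by
    refine (measure_mono fun x hx => ?_).trans (measure_union_le _ _)
    by_cases hxA : x ∈ A
    · exact Or.inl hxA
    · exact Or.inr (Or.inl ⟨hx, hxA⟩)
  have hμs : μ (symmDiff C A) ≤ (ε / 2 : NNReal) := le_self_add.trans hCA.le
  have hνs : ν (symmDiff C A) ≤ (ε / 2 : NNReal) := le_add_self.trans hCA.le
  calc μ A ≤ μ C + (ε / 2 : NNReal) := hμ.trans (by gcongr)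
    _ ≤ ν C + (ε / 2 : NNReal) := add_le_add (h C hC) le_rfl
    _ ≤ ν A + (ε / 2 : NNReal) + (ε / 2 : NNReal) :=
      add_le_add (hν.trans (add_le_add le_rfl hνs)) le_rfl
    _ = ν A + ε := by rw [add_assoc, ← ENNReal.coe_add, add_halves]

/-- Off a `μ`-null set, space is covered by the countably many sets `{|x_j| > 1/(m + 1)}` with `j`
in `U₀`. On each of them both measures are finite and cylinders have bases avoiding the origin. Only
the smaller measure must not charge zero. -/
theorem measure_le_of_finProj_preimage_le {μ ν : Measure (U → ℝ)} (hμ : DoesNotChargeZero μ)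
    (hfin : ∀ (j : U) (ε : ℝ), 0 < ε → ν {x | ε < |x j|} < ∞)
    (h : ∀ (s : Finset U) (A : Set (EuclideanSpace ℝ s)), MeasurableSet A → 0 ∉ A →
      μ (finProj s ⁻¹' A) ≤ ν (finProj s ⁻¹' A)) : μ ≤ ν := by
  classical
  obtain ⟨U₀, hU₀, hμ0⟩ := hμ
  have := hU₀.to_subtype
  let N : Set (U → ℝ) := {x | ∀ j ∈ U₀, x j = 0}
  have hN : MeasurableSet N := by
    have h1 : N = ⋂ j ∈ U₀, (fun x : U → ℝ => x j) ⁻¹' {0} := by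
      ext x
      simp [N]
    rw [h1]
    exact MeasurableSet.biInter hU₀ fun j _ => (measurable_pi_apply j) (measurableSet_singleton 0)
  refine Measure.le_iff.2 fun A hA => ?_
  rw [← measure_sdiff_null (s := A) hμ0]
  refine le_trans ?_ (measure_mono (Set.sdiff_subset (s := A) (t := N)))
  let E : U₀ × ℕ → Set (U → ℝ) := fun p => {x | ((p.2 : ℝ) + 1)⁻¹ < |x p.1|}
  have hEm : ∀ p, MeasurableSet (E p) := fun p =>
    measurableSet_lt measurable_const (measurable_pi_apply _).abs
  have hpos : ∀ m : ℕ, (0 : ℝ) < ((m : ℝ) + 1)⁻¹ := fun m => by positivity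
  refine measure_le_of_subset_iUnion hEm (fun p A' hA' hA'E => ?_) (hA.diff hN) fun x hx => ?_
  · have hcyl : ∀ C ∈ measurableCylinders fun _ : U => ℝ,
        μ.restrict (E p) C ≤ ν.restrict (E p) C := fun C hC => by
      obtain ⟨I, S, hS, rfl⟩ := (mem_measurableCylinders C).1 hC
      rw [Measure.restrict_apply' (hEm p), Measure.restrict_apply' (hEm p)]
      -- Including the coordinate that defines `E p` makes the intersection a cylinder whose base
      -- omits `0`.
      let t : Finset U := insert p.1.1 I
      let B : Set (EuclideanSpace ℝ t) :=
        {y | (fun i : I => y ⟨i, Finset.mem_insert_of_mem i.2⟩) ∈ S ∧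
          ((p.2 : ℝ) + 1)⁻¹ < |y ⟨p.1.1, Finset.mem_insert_self _ _⟩|}
      have hB : MeasurableSet B := by
        have hm1 : Measurable fun (y : EuclideanSpace ℝ t) (i : I) =>
            y ⟨i, Finset.mem_insert_of_mem i.2⟩ := by fun_prop
        have hm2 : Measurable fun y : EuclideanSpace ℝ t =>
            y ⟨p.1.1, Finset.mem_insert_self _ _⟩ := by fun_prop
        exact (hm1 hS).inter (measurableSet_lt measurable_const hm2.abs)
      refine h t B hB fun h0 => ?_
      have h1 := h0.2
      simp only [PiLp.zero_apply, abs_zero] at h1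
      exact absurd h1 (not_lt.2 (hpos _).le)
    have hν : IsFiniteMeasure (ν.restrict (E p)) :=
      ⟨by rw [Measure.restrict_apply_univ]; exact hfin _ _ (hpos _)⟩
    have hμ : IsFiniteMeasure (μ.restrict (E p)) :=
      ⟨(hcyl _ (univ_mem_measurableCylinders _)).trans_lt (measure_lt_top _ _)⟩
    have h1 := measure_le_of_forall_cylinder_le hcyl A'
    rwa [Measure.restrict_apply hA', Measure.restrict_apply hA',
      Set.inter_eq_left.2 hA'E] at h1
  · obtain ⟨j, hj, hxj⟩ : ∃ j ∈ U₀, x j ≠ 0 := by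
      have h1 := hx.2
      simpa [N] using h1
    obtain ⟨m, hm⟩ := exists_nat_one_div_lt (abs_pos.2 hxj)
    rw [one_div] at hm
    exact Set.mem_iUnion.2 ⟨(⟨j, hj⟩, m), hm⟩

end CylinderComparison

/-! ### Passage between fields and finite-dimensional laws -/

section Field

variable {U : Type u} {Ω : Type v} [MeasurableSpace Ω] {P : Measure Ω} {X : U → Ω → ℝ}

theorem measurable_fieldPath (hX : ∀ j, Measurable (X j)) : Measurable (fieldPath X) :=
  measurable_pi_lambda _ hX

/-- Finite-dimensional form of selfdecomposability. -/
theorem IsSelfdecomposableField.exists_charFun_eq (hsd : IsSelfdecomposableField X P)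
    (s : Finset U) {r : ℝ} (hr : 1 < r) :
    ∃ V : Measure (EuclideanSpace ℝ s), IsProbabilityMeasure V ∧ ∀ θ,
      charFun (P.map fun ω => finProj s (fieldPath X ω)) θ
        = charFun (P.map fun ω => finProj s (fieldPath X ω)) (r⁻¹ • θ) * charFun V θ := by
  obtain ⟨Ω', _, P', X', V, hP', hX', hV, hcopy, hind, hlaw⟩ := hsd r hr
  have hX'm := measurable_fieldPath hX'
  have hVm := measurable_fieldPath hV
  have hs := measurable_finProj s
  have hXs : IdentDistrib (fun ω => finProj s (fieldPath X' ω))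
      (fun ω => finProj s (fieldPath X ω)) P' P := hcopy.comp hs
  have hsum : IdentDistrib (fun ω => finProj s (fieldPath X ω))
      (fun ω => r⁻¹ • finProj s (fieldPath X' ω) + finProj s (fieldPath V ω)) P P' :=
    hlaw.comp hs
  refine ⟨P'.map fun ω => finProj s (fieldPath V ω),
    Measure.isProbabilityMeasure_map (hs.comp hVm).aemeasurable, fun θ => ?_⟩
  have hindep : IndepFun (fun ω => r⁻¹ • finProj s (fieldPath X' ω))
      (fun ω => finProj s (fieldPath V ω)) P' :=
    hind.comp (φ := fun x => r⁻¹ • finProj s x) (hs.const_smul r⁻¹) hs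
  have hm1 : Measurable fun ω => finProj s (fieldPath X' ω) := hs.comp hX'm
  have hm2 : Measurable fun ω => finProj s (fieldPath V ω) := hs.comp hVm
  have hm3 : Measurable fun ω => r⁻¹ • finProj s (fieldPath X' ω) := hm1.const_smul r⁻¹
  have h1 : charFun (P'.map fun ω => r⁻¹ • finProj s (fieldPath X' ω)) θ
      = charFun (P.map fun ω => finProj s (fieldPath X ω)) (r⁻¹ • θ) := by
    rw [← hXs.map_eq, ← charFun_map_smul, Measure.map_map (by fun_prop) hm1]
    rfl
  rw [← h1, hsum.map_eq, hindep.charFun_map_fun_add_eq_mul hm3.aemeasurable hm2.aemeasurable]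
  rfl

/-- `η s` and the projection of `ν` need not agree at the origin, but the origin is null for `η s`
and for its dilation, so it can be removed before comparing. -/
theorem IsCharacteristicSystem.map_smul_le_iff {γ : (s : Finset U) → EuclideanSpace ℝ s}
    {B : (s : Finset U) → Matrix s s ℝ} {η : (s : Finset U) → Measure (EuclideanSpace ℝ s)}
    (hsys : IsCharacteristicSystem X P γ B η) {ν : Measure (U → ℝ)}
    (hη : ∀ (s : Finset U) (A : Set (EuclideanSpace ℝ s)), MeasurableSet A → 0 ∉ A →
      η s A = ν (finProj s ⁻¹' A)) {q : ℝ} (hq : 1 < q) (s : Finset U) :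
    ((η s).map fun x => q⁻¹ • x) ≤ η s ↔
      ∀ A : Set (EuclideanSpace ℝ s), MeasurableSet A → 0 ∉ A →
        (ν.map fun x => q⁻¹ • x) (finProj s ⁻¹' A) ≤ ν (finProj s ⁻¹' A) := by
  have hqm : Measurable fun x : EuclideanSpace ℝ s => q⁻¹ • x := by fun_prop
  have hqU : Measurable fun x : U → ℝ => q⁻¹ • x := by fun_prop
  have hkey : ∀ A : Set (EuclideanSpace ℝ s), MeasurableSet A → 0 ∉ A →
      ((η s).map fun x => q⁻¹ • x) A = (ν.map fun x => q⁻¹ • x) (finProj s ⁻¹' A) :=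
    fun A hA h0 => by
    rw [Measure.map_apply hqm hA, Measure.map_apply hqU (measurable_finProj s hA),
      hη s _ (hqm hA) (by simpa using h0)]
    rfl
  refine ⟨fun h A hA h0 => ?_, fun h => Measure.le_iff.2 fun A hA => ?_⟩
  · rw [← hkey A hA h0, ← hη s A hA h0]
    exact h A
  · have hz := (hsys s).isLevyMeasure.measure_zero
    have hz' : ((η s).map fun x => q⁻¹ • x) {0} = 0 := by
      rw [Measure.map_apply hqm (measurableSet_singleton 0)]
      convert hz using 2
      ext x
      simp [(one_pos.trans hq).ne']
    have hA0 := hA.diff (measurableSet_singleton (0 : EuclideanSpace ℝ s))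
    have h0 : (0 : EuclideanSpace ℝ s) ∉ A \ {0} := fun h => h.2 rfl
    rw [← measure_sdiff_null hz, ← measure_sdiff_null hz', hkey _ hA0 h0, hη s _ hA0 h0]
    exact h _ hA0 h0

theorem map_inv_smul_apply {ν : Measure (U → ℝ)} {q : ℝ} (hq : 1 < q) {A : Set (U → ℝ)}
    (hA : MeasurableSet A) : (ν.map fun x => q⁻¹ • x) A = ν (q • A) := by
  rw [Measure.map_apply (by fun_prop) hA, Set.preimage_smul_inv₀ (one_pos.trans hq).ne']

/-- The master Lévy measure of a selfdecomposable field shrinks under dilations. -/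
theorem IsMasterLevyMeasure.measure_smul_le [IsProbabilityMeasure P]
    (hX : ∀ j, Measurable (X j)) {ν : Measure (U → ℝ)}
    (hν : IsMasterLevyMeasure X P ν) (hsd : IsSelfdecomposableField X P) {q : ℝ} (hq : 1 < q)
    {A : Set (U → ℝ)} (hA : MeasurableSet A) : ν (q • A) ≤ ν A := by
  obtain ⟨γ, B, η, hsys, hη⟩ := hν.isPseudoMaster.exists_system
  rw [← map_inv_smul_apply hq hA]
  refine measure_le_of_finProj_preimage_le ?_ (fun j ε hε => ?_) (fun s => ?_) A
  · obtain ⟨U₀, hU₀, h0⟩ := hν.doesNotChargeZero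
    refine ⟨U₀, hU₀, ?_⟩
    have hm : MeasurableSet {x : U → ℝ | ∀ j ∈ U₀, x j = 0} := by
      have h1 : {x : U → ℝ | ∀ j ∈ U₀, x j = 0} = ⋂ j ∈ U₀, (fun x : U → ℝ => x j) ⁻¹' {0} := by
        ext x
        simp
      rw [h1]
      exact MeasurableSet.biInter hU₀ fun j _ => (measurable_pi_apply j) (measurableSet_singleton 0)
    rw [Measure.map_apply (by fun_prop) hm]
    convert h0 using 2
    ext x
    simp [(one_pos.trans hq).ne']
  · have hint : Integrable (fun x : U → ℝ => min 1 (|x j| ^ 2)) ν := by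
      refine ⟨(measurable_const.min
        ((measurable_pi_apply j).abs.pow_const 2)).aestronglyMeasurable, ?_⟩
      rw [hasFiniteIntegral_iff_ofReal (Filter.Eventually.of_forall fun x => by positivity)]
      exact hν.isPseudoMaster.lintegral_lt_top j
    refine (measure_mono fun x hx => ?_).trans_lt
      (hint.measure_ge_lt_top (ε := min 1 (ε ^ 2)) (by positivity))
    have hx' : ε < |x j| := hx
    have h2 : ε ^ 2 ≤ |x j| ^ 2 := by gcongr
    exact min_le_min_left 1 h2
  · rw [← hsys.map_smul_le_iff hη hq s]
    have hp : IsProbabilityMeasure (P.map fun ω => finProj s (fieldPath X ω)) :=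
      Measure.isProbabilityMeasure_map
        ((measurable_finProj s).comp (measurable_fieldPath hX)).aemeasurable
    exact (hsys s).map_smul_le (fun r hr => hsd.exists_charFun_eq s hr) hq

theorem charFun_map_continuousLinearMap {E F : Type*} [NormedAddCommGroup E]
    [InnerProductSpace ℝ E] [CompleteSpace E] [MeasurableSpace E] [BorelSpace E]
    [NormedAddCommGroup F] [InnerProductSpace ℝ F] [CompleteSpace F] [MeasurableSpace F]
    [BorelSpace F] [SecondCountableTopology F] (L : E →L[ℝ] F) (μ : Measure E) (t : F) :
    charFun (μ.map L) t = charFun μ (ContinuousLinearMap.adjoint L t) := by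
  rw [charFun_apply, charFun_apply, integral_map (by fun_prop) (by fun_prop)]
  simp only [ContinuousLinearMap.adjoint_inner_right]

/-- A field is selfdecomposable as soon as the required quotients of characteristic functions of
its finite-dimensional distributions are characteristic functions. -/
theorem isSelfdecomposableField_of_charFun [IsProbabilityMeasure P] (hX : ∀ j, Measurable (X j))
    (hne : ∀ (s : Finset U) θ, charFun (P.map fun ω => finProj s (fieldPath X ω)) θ ≠ 0)
    (h : ∀ (q : ℝ), 1 < q → ∀ s : Finset U, ∃ V : Measure (EuclideanSpace ℝ s),
      IsProbabilityMeasure V ∧ ∀ θ, charFun (P.map fun ω => finProj s (fieldPath X ω)) θ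
        = charFun (P.map fun ω => finProj s (fieldPath X ω)) (q⁻¹ • θ) * charFun V θ) :
    IsSelfdecomposableField X P := by
  intro q hq
  have hXm := measurable_fieldPath hX
  choose V hV hVchar using h q hq
  let κ : (s : Finset U) → Measure (EuclideanSpace ℝ s) := fun s =>
    P.map fun ω => finProj s (fieldPath X ω)
  have hproj : IsProjectiveMeasureFamily (α := fun _ => ℝ)
      fun s : Finset U => (V s).map (WithLp.ofLp : EuclideanSpace ℝ s → s → ℝ) := by
    intro I J hJI
    let R : EuclideanSpace ℝ I →L[ℝ] EuclideanSpace ℝ J := EuclideanSpace.restrict₂ hJI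
    have hR : κ J = (κ I).map R :=
      (Measure.map_map R.measurable ((measurable_finProj I).comp hXm)).symm
    have hVR : V J = (V I).map R := by
      have : IsProbabilityMeasure ((V I).map R) := Measure.isProbabilityMeasure_map (by fun_prop)
      refine Measure.ext_of_charFun (funext fun θ => ?_)
      -- Nonvanishing of the characteristic function makes the quotient law unique, which forces
      -- consistency under projections.
      refine mul_left_cancel₀ (hne J (q⁻¹ • θ)) ?_
      rw [← hVchar J θ]
      change charFun (κ J) θ = charFun (κ J) (q⁻¹ • θ) * _
      rw [hR, charFun_map_continuousLinearMap, charFun_map_continuousLinearMap,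
        charFun_map_continuousLinearMap, map_smul]
      exact hVchar I _
    have h1 : ((V I).map R).map WithLp.ofLp = (V I).map (WithLp.ofLp ∘ R) :=
      Measure.map_map (by fun_prop) R.measurable
    have h2 : ((V I).map (WithLp.ofLp : EuclideanSpace ℝ I → I → ℝ)).map
        (Finset.restrict₂ (π := fun _ => ℝ) hJI) = (V I).map (WithLp.ofLp ∘ R) :=
      Measure.map_map (Finset.measurable_restrict₂ hJI) (by fun_prop)
    change (V J).map _ = ((V I).map _).map _
    rw [h2, ← h1, ← hVR]
  have hprob : ∀ s : Finset U,
      IsProbabilityMeasure ((V s).map (WithLp.ofLp : EuclideanSpace ℝ s → s → ℝ)) := fun s =>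
    Measure.isProbabilityMeasure_map (by fun_prop)
  obtain ⟨Q, hQ⟩ := exists_isProjectiveLimit hproj
  have hQp : IsProbabilityMeasure Q := hQ.isProbabilityMeasure
  have hQV : ∀ s, Q.map (finProj s) = V s := fun s => by
    have h1 : (Q.map (s.restrict (π := fun _ => ℝ))).map
        (WithLp.toLp 2 : (s → ℝ) → EuclideanSpace ℝ s) = Q.map (finProj s) :=
      Measure.map_map (by fun_prop) (Finset.measurable_restrict s)
    rw [← h1, hQ s, Measure.map_map (by fun_prop) (by fun_prop)]
    simp [Function.comp_def]
  let μ : Measure (U → ℝ) := P.map (fieldPath X)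
  have hμp : IsProbabilityMeasure μ := Measure.isProbabilityMeasure_map hXm.aemeasurable
  refine ⟨(U → ℝ) × (U → ℝ), inferInstance, μ.prod Q, fun j ω => ω.1 j, fun j ω => ω.2 j,
    inferInstance, fun j => by fun_prop, fun j => by fun_prop, ?_, ?_, ?_⟩
  · refine ⟨measurable_fst.aemeasurable, hXm.aemeasurable, ?_⟩
    change (μ.prod Q).map Prod.fst = μ
    rw [Measure.map_fst_prod]
    simp
  · change IndepFun (Prod.fst : (U → ℝ) × (U → ℝ) → U → ℝ) Prod.snd (μ.prod Q)
    rw [indepFun_iff_map_prod_eq_prod_map_map measurable_fst.aemeasurable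
      measurable_snd.aemeasurable, Measure.map_fst_prod, Measure.map_snd_prod]
    simp
  · have hm : Measurable fun ω : (U → ℝ) × (U → ℝ) => q⁻¹ • ω.1 + ω.2 := by fun_prop
    refine ⟨hXm.aemeasurable, hm.aemeasurable, ?_⟩
    change μ = (μ.prod Q).map fun ω => q⁻¹ • ω.1 + ω.2
    have hσp : IsProbabilityMeasure ((μ.prod Q).map fun ω => q⁻¹ • ω.1 + ω.2) :=
      Measure.isProbabilityMeasure_map hm.aemeasurable
    have hfin : ∀ s, μ.map (finProj s)
        = ((μ.prod Q).map fun ω => q⁻¹ • ω.1 + ω.2).map (finProj s) := fun s => by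
      have hs := measurable_finProj s
      have h1 : μ.map (finProj s) = κ s := Measure.map_map hs hXm
      have hp1 : IsProbabilityMeasure (μ.map (finProj s)) :=
        Measure.isProbabilityMeasure_map hs.aemeasurable
      have hp2 : IsProbabilityMeasure
          (((μ.prod Q).map fun ω => q⁻¹ • ω.1 + ω.2).map (finProj s)) :=
        Measure.isProbabilityMeasure_map hs.aemeasurable
      have hi : IndepFun (fun ω : (U → ℝ) × (U → ℝ) => q⁻¹ • finProj s ω.1)
          (fun ω => finProj s ω.2) (μ.prod Q) :=
        indepFun_prod (X := fun x => q⁻¹ • finProj s x) (hs.const_smul q⁻¹) hs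
      have hm1 : Measurable fun ω : (U → ℝ) × (U → ℝ) => q⁻¹ • finProj s ω.1 :=
        (hs.comp measurable_fst).const_smul q⁻¹
      have hm2 : Measurable fun ω : (U → ℝ) × (U → ℝ) => finProj s ω.2 := hs.comp measurable_snd
      refine Measure.ext_of_charFun (funext fun θ => ?_)
      rw [Measure.map_map hs hm]
      change _ = charFun ((μ.prod Q).map
        fun ω => q⁻¹ • finProj s ω.1 + finProj s ω.2) θ
      rw [hi.charFun_map_fun_add_eq_mul hm1.aemeasurable hm2.aemeasurable, Pi.mul_apply, h1]
      have h2 : (μ.prod Q).map (fun ω => q⁻¹ • finProj s ω.1)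
          = (κ s).map fun x => q⁻¹ • x := by
        rw [← h1, Measure.map_map (by fun_prop) hs]
        have h3 : μ = (μ.prod Q).map Prod.fst := by rw [Measure.map_fst_prod]; simp
        conv_rhs => rw [h3]
        rw [Measure.map_map (by fun_prop) measurable_fst]
        rfl
      have h4 : (μ.prod Q).map (fun ω => finProj s ω.2) = V s := by
        rw [← hQV s]
        have h3 : Q = (μ.prod Q).map Prod.snd := by rw [Measure.map_snd_prod]; simp
        conv_rhs => rw [h3]
        rw [Measure.map_map hs measurable_snd]
        rfl
      rw [h2, h4, charFun_map_smul]
      exact hVchar s θ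
    have hrestr : ∀ (m : Measure (U → ℝ)) (s : Finset U),
        m.map s.restrict = (m.map (finProj s)).map WithLp.ofLp := fun m s => by
      rw [Measure.map_map (by fun_prop) (measurable_finProj s)]
      rfl
    have hlim1 : IsProjectiveLimit (α := fun _ => ℝ) μ fun s : Finset U => μ.map s.restrict :=
      fun s => rfl
    have hlim2 : IsProjectiveLimit (α := fun _ => ℝ)
        ((μ.prod Q).map fun ω => q⁻¹ • ω.1 + ω.2) fun s : Finset U => μ.map s.restrict :=
      fun s => by rw [hrestr, ← hfin s, ← hrestr]
    have : ∀ s : Finset U, IsFiniteMeasure (μ.map s.restrict) := fun s => inferInstance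
    exact hlim1.unique hlim2

/-- A field with a pseudo master Lévy measure that shrinks under dilations is selfdecomposable. -/
theorem IsPseudoMasterLevyMeasure.isSelfdecomposableField [IsProbabilityMeasure P]
    (hX : ∀ j, Measurable (X j)) {ν : Measure (U → ℝ)} (hν : IsPseudoMasterLevyMeasure X P ν)
    (hle : ∀ q : ℝ, 1 < q → ∀ A : Set (U → ℝ), MeasurableSet A → ν (q • A) ≤ ν A) :
    IsSelfdecomposableField X P := by
  obtain ⟨γ, B, η, hsys, hη⟩ := hν.exists_system
  refine isSelfdecomposableField_of_charFun hX (fun s θ => ?_) fun q hq s => ?_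
  · rw [(hsys s).charFun_eq]
    exact Complex.exp_ne_zero _
  · have hηle : ((η s).map fun x => q⁻¹ • x) ≤ η s :=
      (hsys.map_smul_le_iff hη hq s).2 fun A hA _ => by
        rw [map_inv_smul_apply hq (measurable_finProj s hA)]
        exact hle q hq _ (measurable_finProj s hA)
    obtain ⟨V, hV, hVchar⟩ := exists_charFun_eq_exp_sub (hsys s).isLevyMeasure (γ s)
      (hsys s).posSemidef hq hηle
    refine ⟨V, hV, fun θ => ?_⟩
    rw [hVchar, (hsys s).charFun_eq, (hsys s).charFun_eq, ← Complex.exp_add, add_sub_cancel]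

end Field

theorem mainTheorem3 {U : Type u} [Nonempty U] {Ω : Type v} [MeasurableSpace Ω]
    (P : Measure Ω) [IsProbabilityMeasure P] (X : U → Ω → ℝ) (hX : ∀ j, Measurable (X j))
    (hID : IsInfinitelyDivisibleField X P) :
    (∀ (Γ : U → ℝ) (B : U → U → ℝ) (ν : Measure (U → ℝ)), HasCharacteristicTriplet X P Γ B ν →
      (IsSelfdecomposableField X P ↔
        ∀ q : ℝ, 1 < q → ∀ A : Set (U → ℝ), MeasurableSet A → ν (q • A) ≤ ν A)) ∧
    (∀ ν : Measure (U → ℝ), IsPseudoMasterLevyMeasure X P ν →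
      (∀ q : ℝ, 1 < q → ∀ A : Set (U → ℝ), MeasurableSet A → ν (q • A) ≤ ν A) →
      IsSelfdecomposableField X P) :=
  ⟨fun _ _ _ h => ⟨fun hsd _ hq _ hA => h.isMaster.measure_smul_le hX hsd hq hA,
    h.isMaster.isPseudoMaster.isSelfdecomposableField hX⟩,
    fun _ hν => hν.isSelfdecomposableField hX⟩
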